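/- For integers $k\ge 2$ and $0\le d<k$, and real $X\ge 1$, let $I_{k,d}(X)$ denote the number of pairs $(\mathbf x,\mathbf y)\in\mathbb Z^k\times\mathbb Z^k$ with $1\le x_i,y_i\le X$ $(1\le i\le k)$ satisfying $$x_1^j+\cdots+x_k^j=y_1^j+\cdots+y_k^j\qquad (1\le j\le k,\ j\ne k-d),$$ and let $T_k(X)$ denote the number of such pairs $(\mathbf x,\mathbf y)$ with $1\le x_i,y_i\le X$ for which $(x_1,\ldots,x_k)$ is a permutation of $(y_1,\ldots,y_k)$. (i) For every integer $k\ge 2$ there is a constant $C=C(k)>0$ such that, for all integers $d$ with $0\le d\le \sqrt k$ and all real $X\ge 1$, $$|I_{k,d}(X)-T_k(X)|\le C\,X^{\sqrt{4k+1}+d(d+1)/2}.$$ (ii) Let $d=d(k)$ be any sequence of non-negative integers with $d(k)=o(k^{1/4})$ as $k\to\infty$. Then there is a real sequence $e(k)$, with $e(k)\to 0$ as $k\to\infty$, such that for every integer $k\ge 2$ with $d(k)<k$ there is a constant $C>0$ (which may depend on $k$ and $d(k)$) for which, for all real $X\ge 1$, $$|I_{k,d(k)}(X)-T_k(X)|\le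 C\,X^{(2+e(k))\sqrt k}.$$ -/

import Mathlib

open Filter Topology Asymptotics

/-- The pairs `(x, y)` of integral `k`-tuples with `1 ≤ x i, y i ≤ X` such that
`∑ i, x i ^ j = ∑ i, y i ^ j` for every `1 ≤ j ≤ k` other than `j = k - d`
(written `j + d ≠ k`, so that no truncated subtraction is involved). -/
def incompleteVinogradovSolutions (k d : ℕ) (X : ℝ) : Set ((Fin k → ℤ) × (Fin k → ℤ)) :=
  {p | (∀ i, (1 ≤ p.1 i ∧ (p.1 i : ℝ) ≤ X) ∧ (1 ≤ p.2 i ∧ (p.2 i : ℝ) ≤ X)) ∧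
    ∀ j : ℕ, 1 ≤ j → j ≤ k → j + d ≠ k → ∑ i, p.1 i ^ j = ∑ i, p.2 i ^ j}

/-- The pairs `(x, y)` of integral `s`-tuples with `1 ≤ x i, y i ≤ X` such that `x` is a
permutation of `y`. -/
def diagonalSolutions (s : ℕ) (X : ℝ) : Set ((Fin s → ℤ) × (Fin s → ℤ)) :=
  {p | (∀ i, (1 ≤ p.1 i ∧ (p.1 i : ℝ) ≤ X) ∧ (1 ≤ p.2 i ∧ (p.2 i : ℝ) ≤ X)) ∧
    ∃ σ : Equiv.Perm (Fin s), ∀ i, p.1 i = p.2 (σ i)}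

/-- `I_{k,d}(X)`. -/
noncomputable def solutionCount (k d : ℕ) (X : ℝ) : ℕ :=
  (incompleteVinogradovSolutions k d X).ncard

/-- `T_s(X)`. -/
noncomputable def diagonalCount (s : ℕ) (X : ℝ) : ℕ :=
  (diagonalSolutions s X).ncard

/-- Boxes are finite, so the two counts are genuine cardinalities. -/
theorem finite_of_bounded_pairs (k : ℕ) (X : ℝ) (S : Set ((Fin k → ℤ) × (Fin k → ℤ)))
    (hS : ∀ p ∈ S, ∀ i, (1 ≤ p.1 i ∧ (p.1 i : ℝ) ≤ X) ∧ (1 ≤ p.2 i ∧ (p.2 i : ℝ) ≤ X)) :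
    S.Finite := by
  refine ((Set.finite_Icc (fun _ : Fin k => (1 : ℤ)) (fun _ => ⌊X⌋)).prod
    (Set.finite_Icc (fun _ : Fin k => (1 : ℤ)) (fun _ => ⌊X⌋))).subset ?_
  intro p hp
  exact ⟨⟨fun i => (hS p hp i).1.1, fun i => Int.le_floor.2 (hS p hp i).1.2⟩,
    ⟨fun i => (hS p hp i).2.1, fun i => Int.le_floor.2 (hS p hp i).2.2⟩⟩

theorem incompleteVinogradovSolutions_finite (k d : ℕ) (X : ℝ) :
    (incompleteVinogradovSolutions k d X).Finite :=
  finite_of_bounded_pairs k X _ fun _ hp => hp.1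

theorem diagonalSolutions_finite (s : ℕ) (X : ℝ) : (diagonalSolutions s X).Finite :=
  finite_of_bounded_pairs s X _ fun _ hp => hp.1

/-! Diagonal pairs solve the system, so the non-diagonal solutions in `[1, N]` are to be counted.
When `2 * d < k`, Newton's identities give `∏ (t - x i) - ∏ (t - y i) = h * q t`
(`prod_sub_sub_prod_sub`), where `q` is monic of degree `d` with the leading coefficients of `∏ (t -
y i)`, and `h ≠ 0`, `h = O(N ^ (k - d))`.

Putting `t = y j` gives `∏ i, (y j - x i) = h * q (y j)`. If `y` has at least `R + d` distinct
entries, `R` of them, `z j`, are not roots of `q`. Each factors `|h|` into `k` parts, up to divisors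
of `q (z j)`; a common refinement of these factorisations is a family `α f` indexed by `f : Fin R →
Fin k`. Fix the `z j` and the coefficients of `q`, at a cost of `N ^ (R + d(d+1)/2)`, and reveal the
`x i` one by one. At each stage `α f` divides a number already known, hence has `O(N ^ ε)` values,
unless the `p`-th entry of `f` comes strictly first. For different `p` these exceptional sets are
disjoint, so some `p` has exceptional product `P ≤ |h| ^ (1 / R)`. Fixing `P` as well makes every `α
f` a divisor of something known (`eq_of_divisorIndex_eq`), and the count is `O(N ^ (R + d(d+1)/2 +
(k-d)/R + ε))`. If `y` has fewer distinct entries the count is `O(N ^ (R + d))`.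

The best integer `R` satisfies `R + (k-d)/R ≤ √(4(k-d)+1)`. For `d > 0` this is below `√(4k+1)`,
which leaves room for `ε`. For `d = 0` there is no room exactly when `k = R(R+1)`. A power saving is
then found by playing the row order against a second order of revelation, in which one column is
found late (`exists_sum_le_of_marginals`): weights `log α f` extremal for all row orders are too
uniform to be extremal for the other one. The remaining small cases, and `d > √k` in (ii), use
trivial bounds. -/

/-! ### The divisor bound and labels for divisors. -/

theorem succ_le_mul_rpow {ε : ℝ} (hε : 0 < ε) {p : ℕ} (hp : 2 ≤ p) (a : ℕ) :
    ((a : ℝ) + 1) ≤ max 1 (1 / (ε * Real.log 2)) * ((p : ℝ) ^ a) ^ ε := by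
  have hl : 0 < ε * Real.log 2 := mul_pos hε (Real.log_pos one_lt_two)
  have h2 : (2 : ℝ) ≤ p := by exact_mod_cast hp
  have h1 : 1 + a * (ε * Real.log 2) ≤ ((p : ℝ) ^ a) ^ ε := by
    have e1 : ((2 : ℝ) ^ a) ^ ε ≤ ((p : ℝ) ^ a) ^ ε := by gcongr
    refine le_trans ?_ e1
    rw [← Real.rpow_natCast, ← Real.rpow_mul zero_le_two, Real.rpow_def_of_pos two_pos]
    have := Real.add_one_le_exp (Real.log 2 * (a * ε))
    linarith
  have hK1 : 1 ≤ max 1 (1 / (ε * Real.log 2)) := le_max_left _ _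
  have hK2 : 1 ≤ max 1 (1 / (ε * Real.log 2)) * (ε * Real.log 2) := by
    rw [← div_le_iff₀ hl]; exact le_max_right _ _
  have ha : (0 : ℝ) ≤ a := a.cast_nonneg
  calc (a : ℝ) + 1 ≤ max 1 (1 / (ε * Real.log 2)) * (1 + a * (ε * Real.log 2)) := by nlinarith
    _ ≤ _ := by gcongr

theorem succ_le_rpow_of_large {ε : ℝ} {p : ℕ} (hp : (2 : ℝ) ≤ (p : ℝ) ^ ε) (a : ℕ) :
    ((a : ℝ) + 1) ≤ ((p : ℝ) ^ a) ^ ε := by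
  rw [← Real.rpow_natCast, ← Real.rpow_mul p.cast_nonneg, mul_comm,
    Real.rpow_mul p.cast_nonneg, Real.rpow_natCast]
  have h1 : ((a : ℝ) + 1) ≤ 2 ^ a := by exact_mod_cast Nat.lt_two_pow_self (n := a)
  exact h1.trans (by gcongr)

/-- The divisor bound `τ(n) ≪ n ^ ε`. -/
theorem exists_card_divisors_le {ε : ℝ} (hε : 0 < ε) :
    ∃ C : ℝ, 1 ≤ C ∧ ∀ n : ℕ, n ≠ 0 → (n.divisors.card : ℝ) ≤ C * (n : ℝ) ^ ε := by
  set K := max 1 (1 / (ε * Real.log 2)) with hK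
  have hK1 : 1 ≤ K := le_max_left _ _
  -- A prime `p ≥ 2 ^ (1 / ε)` has `a + 1 ≤ 2 ^ a ≤ p ^ (a ε)` and costs nothing; each of the fewer
  -- than `B` smaller primes costs a factor `K`.
  set B := ⌈(2 : ℝ) ^ (1 / ε)⌉₊ with hB
  refine ⟨K ^ B, one_le_pow₀ hK1, fun n hn => ?_⟩
  have hpf : ∀ p ∈ n.primeFactors, ((n.factorization p : ℝ) + 1) ≤
      (if p < B then K else 1) * ((p : ℝ) ^ n.factorization p) ^ ε := by
    intro p hp
    split_ifs with hpB
    · exact succ_le_mul_rpow hε (Nat.prime_of_mem_primeFactors hp).two_le _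
    · rw [one_mul]
      refine succ_le_rpow_of_large ?_ _
      have h1 : (2 : ℝ) ^ (1 / ε) ≤ p := (Nat.le_ceil _).trans (by exact_mod_cast not_lt.1 hpB)
      calc (2 : ℝ) = ((2 : ℝ) ^ (1 / ε)) ^ ε := by
            rw [← Real.rpow_mul zero_le_two, one_div_mul_cancel hε.ne', Real.rpow_one]
        _ ≤ _ := by gcongr
  have hprod : (n : ℝ) ^ ε = ∏ p ∈ n.primeFactors, ((p : ℝ) ^ n.factorization p) ^ ε := by
    rw [Real.finsetProd_rpow _ _ (fun i _ => by positivity)]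
    congr 1
    conv_lhs => rw [← Nat.prod_factorization_pow_eq_self hn]
    rw [Finsupp.prod, Nat.cast_prod, Nat.support_factorization]
    simp
  rw [Nat.card_divisors hn, Nat.cast_prod, hprod]
  push_cast
  refine (Finset.prod_le_prod (fun i _ => by positivity) hpf).trans ?_
  rw [Finset.prod_mul_distrib]
  gcongr
  rw [← Finset.prod_filter, Finset.prod_const]
  refine pow_le_pow_right₀ hK1 ?_
  calc _ ≤ (Finset.range B).card := Finset.card_le_card fun p hp => by
        simpa using (Finset.mem_filter.1 hp).2
    _ = B := Finset.card_range B

theorem exists_card_divisors_le_of_le_pow {ε : ℝ} (hε : 0 < ε) (B A : ℕ) :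
    ∃ C : ℝ, 1 ≤ C ∧ ∀ N : ℕ, 1 ≤ N → ∀ n : ℕ, n ≠ 0 → n ≤ B * N ^ A →
      (n.divisors.card : ℝ) ≤ C * (N : ℝ) ^ ε := by
  obtain ⟨C, hC1, hC⟩ := exists_card_divisors_le (ε := ε / (A + 1)) (by positivity)
  refine ⟨C * (max 1 B : ℝ) ^ (ε / (A + 1)), ?_, fun N hN n hn hle => ?_⟩
  · exact one_le_mul_of_one_le_of_one_le hC1
      (Real.one_le_rpow (le_max_left _ _) (by positivity))
  have hN1 : (1 : ℝ) ≤ N := by exact_mod_cast hN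
  have hle' : (n : ℝ) ≤ max 1 (B : ℝ) * (N : ℝ) ^ A := by
    have : (n : ℝ) ≤ B * (N : ℝ) ^ A := by exact_mod_cast hle
    exact this.trans (by gcongr; exact le_max_right _ _)
  refine (hC n hn).trans ?_
  rw [mul_assoc]
  gcongr
  calc (n : ℝ) ^ (ε / (A + 1)) ≤ (max 1 (B : ℝ) * (N : ℝ) ^ A) ^ (ε / (A + 1)) := by gcongr
    _ = (max 1 B : ℝ) ^ (ε / (A + 1)) * ((N : ℝ) ^ A) ^ (ε / (A + 1)) :=
        Real.mul_rpow (by positivity) (by positivity)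
    _ ≤ _ := by
        gcongr
        rw [← Real.rpow_natCast, ← Real.rpow_mul (by positivity)]
        refine Real.rpow_le_rpow_of_exponent_le hN1 ?_
        rw [mul_div_assoc', div_le_iff₀ (by positivity)]
        nlinarith

/-- The position of a divisor `e` in the increasing list of divisors of `n`. -/
def divisorIndex (n e : ℕ) : ℕ := (n.divisors.filter (· < e)).card

theorem divisorIndex_lt {n e : ℕ} (hn : n ≠ 0) (he : e ∣ n) :
    divisorIndex n e < n.divisors.card := by
  refine Finset.card_lt_card ((Finset.filter_ssubset).2 ⟨e, ?_, lt_irrefl e⟩)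
  exact Nat.mem_divisors.2 ⟨he, hn⟩

theorem divisorIndex_injOn {n e e' : ℕ} (hn : n ≠ 0) (he : e ∣ n) (he' : e' ∣ n)
    (h : divisorIndex n e = divisorIndex n e') : e = e' := by
  have key : ∀ a b : ℕ, a ∣ n → a < b → divisorIndex n a < divisorIndex n b := by
    intro a b ha hab
    refine Finset.card_lt_card ⟨fun z hz => ?_, fun hsub => ?_⟩
    · rw [Finset.mem_filter] at hz ⊢
      exact ⟨hz.1, hz.2.trans hab⟩
    · have := hsub (Finset.mem_filter.2 ⟨Nat.mem_divisors.2 ⟨ha, hn⟩, hab⟩)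
      exact lt_irrefl a (Finset.mem_filter.1 this).2
  rcases lt_trichotomy e e' with hlt | heq | hgt
  · exact absurd h (key e e' he hlt).ne
  · exact heq
  · exact absurd h (key e' e he' hgt).ne'

/-! ### Common refinements of factorisations. -/

theorem exists_dvd_prod_eq {ι : Type*} (s : Finset ι) (a : ι → ℕ) :
    ∀ b, b ∣ ∏ i ∈ s, a i → ∃ e : ι → ℕ, (∀ i, e i ∣ a i) ∧ ∏ i ∈ s, e i = b := by
  classical
  induction s using Finset.induction_on with
  | empty => exact fun b hb => ⟨fun _ => 1, fun _ => one_dvd _, by simpa [eq_comm] using hb⟩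
  | insert i s his ih =>
    intro b hb
    rw [Finset.prod_insert his] at hb
    obtain ⟨b1, b2, h1, h2, rfl⟩ := exists_dvd_and_dvd_of_dvd_mul hb
    obtain ⟨e, he, hprod⟩ := ih b2 h2
    refine ⟨Function.update e i b1, fun j => ?_, ?_⟩
    · by_cases hj : j = i
      · subst hj; simpa using h1
      · simpa [hj] using he j
    · rw [Finset.prod_insert his, Function.update_self, ← hprod]
      congr 1
      refine Finset.prod_congr rfl fun j hj => ?_
      rw [Function.update_of_ne (ne_of_mem_of_not_mem hj his)]

/-- Induction on `t`: `b j` divides `∏ a i`, so it splits into divisors `e i ∣ a i`; these form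
column `j`, and the cofactors are refined against the remaining columns. -/
theorem exists_refinement_pair {ι κ : Type*} [Fintype ι] (t : Finset κ) (b : κ → ℕ)
    (hb : ∀ j, b j ≠ 0) : ∀ a : ι → ℕ, ∏ i, a i = ∏ j ∈ t, b j →
      ∃ c : ι → κ → ℕ, (∀ i, ∏ j ∈ t, c i j = a i) ∧ ∀ j ∈ t, ∏ i, c i j = b j := by
  classical
  induction t using Finset.induction_on with
  | empty =>
    intro a ha
    refine ⟨fun _ _ => 1, fun i => ?_, by simp⟩
    have := Finset.dvd_prod_of_mem a (Finset.mem_univ i)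
    rw [ha] at this
    simpa [eq_comm] using this
  | insert j t hjt ih =>
    intro a ha
    rw [Finset.prod_insert hjt] at ha
    obtain ⟨e, he, hprod⟩ := exists_dvd_prod_eq Finset.univ a (b j) (ha ▸ dvd_mul_right _ _)
    choose a' ha' using he
    obtain ⟨c, hc1, hc2⟩ := ih a' (by
      simp_rw [ha', Finset.prod_mul_distrib, hprod] at ha
      exact Nat.eq_of_mul_eq_mul_left (Nat.pos_of_ne_zero (hb j)) ha)
    refine ⟨fun i => Function.update (c i) j (e i), fun i => ?_, fun l hl => ?_⟩
    · dsimp only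
      rw [Finset.prod_insert hjt, Function.update_self, ha' i, ← hc1 i]
      congr 1
      refine Finset.prod_congr rfl fun l hl => ?_
      rw [Function.update_of_ne (ne_of_mem_of_not_mem hl hjt)]
    · rcases Finset.mem_insert.1 hl with rfl | hl
      · simpa using hprod
      · simpa [ne_of_mem_of_not_mem hl hjt] using hc2 l hl

/-- The common refinement of `R` factorisations of `H` into `k` factors. -/
theorem exists_refinement {k : ℕ} {H : ℕ} (hH : H ≠ 0) (R : ℕ) :
    ∀ v : Fin k → Fin R → ℕ, (∀ j, ∏ i, v i j = H) →
      ∃ α : (Fin R → Fin k) → ℕ, ∏ f, α f = H ∧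
        ∀ i j, ∏ f with f j = i, α f = v i j := by
  induction R with
  | zero => exact fun v _ => ⟨fun _ => H, by simp, fun i j => j.elim0⟩
  | succ R ih =>
    intro v hv
    -- The last `R` columns are refined first; their refinement, itself a factorisation of `H`, is
    -- then refined against column `0`.
    obtain ⟨α, hα1, hα2⟩ := ih (fun i j => v i j.succ) fun j => hv j.succ
    have hv0 : ∀ i, v i 0 ≠ 0 := fun i h0 => hH (by
      rw [← hv 0]; exact Finset.prod_eq_zero (Finset.mem_univ i) h0)
    obtain ⟨c, hc1, hc2⟩ := exists_refinement_pair Finset.univ (fun i => v i 0) hv0 α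
      (by rw [hα1, hv 0])
    have hsplit : ∀ F : (Fin (R + 1) → Fin k) → ℕ,
        ∏ f, F f = ∏ g : Fin R → Fin k, ∏ i : Fin k, F (Fin.cons i g) := by
      intro F
      rw [← (Fin.consEquiv fun _ => Fin k).prod_comp, Fintype.prod_prod_type, Finset.prod_comm]
      rfl
    refine ⟨fun f => c (Fin.tail f) (f 0), ?_, fun i j => ?_⟩
    · rw [hsplit, ← hα1]
      refine Finset.prod_congr rfl fun g _ => ?_
      simpa using hc1 g
    · rw [Finset.prod_filter, hsplit]
      refine Fin.cases ?_ (fun j => ?_) j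
      · rw [← hc2 i (Finset.mem_univ i)]
        refine Finset.prod_congr rfl fun g _ => ?_
        simp
      · rw [← hα2 i j, Finset.prod_filter]
        refine Finset.prod_congr rfl fun g _ => ?_
        simp only [Fin.cons_succ, Fin.tail_cons, Fin.cons_zero]
        split_ifs
        · exact hc1 g
        · simp

/-! ### Newton's identities and the polynomial identity. -/

/-- The `m`-th elementary symmetric polynomial of an integral tuple. -/
def esymmTuple {k : ℕ} (m : ℕ) (x : Fin k → ℤ) : ℤ :=
  ∑ t ∈ Finset.powersetCard m Finset.univ, ∏ i ∈ t, x i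

theorem esymmTuple_zero {k : ℕ} (x : Fin k → ℤ) : esymmTuple 0 x = 1 := by
  simp [esymmTuple]

theorem esymmTuple_eq_esymm {k : ℕ} (m : ℕ) (x : Fin k → ℤ) :
    esymmTuple m x = (Finset.univ.val.map x).esymm m := by
  rw [Finset.esymm_map_val, esymmTuple]

theorem esymmTuple_newton {k : ℕ} (m : ℕ) (x : Fin k → ℤ) :
    (m : ℤ) * esymmTuple m x =
      (-1) ^ (m + 1) * ∑ a ∈ Finset.range m, (-1) ^ a * esymmTuple a x * ∑ i, x i ^ (m - a) := by
  have h := congrArg (MvPolynomial.aeval x) (MvPolynomial.mul_esymm_eq_sum (Fin k) ℤ m)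
  simp only [map_mul, map_natCast, map_pow, map_neg, map_one, map_sum,
    MvPolynomial.aeval_esymm_eq_multiset_esymm, MvPolynomial.psum, MvPolynomial.aeval_X,
    ← esymmTuple_eq_esymm] at h
  rw [h, Finset.sum_filter, Finset.Nat.sum_antidiagonal_eq_sum_range_succ_mk,
    Finset.sum_range_succ]
  simp only [lt_irrefl, if_false, add_zero]
  congr 1
  refine Finset.sum_congr rfl fun a ha => ?_
  rw [if_pos (Finset.mem_range.1 ha)]

theorem prod_sub_eq_sum_esymmTuple {k : ℕ} (x : Fin k → ℤ) (t : ℤ) :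
    ∏ i, (t - x i) = ∑ j ∈ Finset.range (k + 1), (-1) ^ j * esymmTuple j x * t ^ (k - j) := by
  have h := congrArg (Polynomial.eval t)
    (Multiset.prod_X_sub_X_eq_sum_esymm (Finset.univ.val.map x))
  rw [Polynomial.eval_multiset_prod, Multiset.map_map, Multiset.map_map] at h
  simp only [Function.comp_def, Polynomial.eval_sub, Polynomial.eval_X, Polynomial.eval_C,
    Multiset.card_map, Finset.card_val, Finset.card_univ, Fintype.card_fin,
    Polynomial.eval_finsetSum, Polynomial.eval_mul, Polynomial.eval_pow, Polynomial.eval_neg,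
    Polynomial.eval_one, ← esymmTuple_eq_esymm] at h
  rw [Finset.prod, h]
  exact Finset.sum_congr rfl fun j _ => by ring

theorem esymmTuple_eq_of_powerSums {k n : ℕ} {x y : Fin k → ℤ}
    (h : ∀ j, 1 ≤ j → j < n → ∑ i, x i ^ j = ∑ i, y i ^ j) :
    ∀ m, m < n → esymmTuple m x = esymmTuple m y := by
  intro m
  induction m using Nat.strong_induction_on with
  | _ m ih =>
    intro hm
    rcases Nat.eq_zero_or_pos m with rfl | hpos
    · simp [esymmTuple_zero]
    have hm0 : (m : ℤ) ≠ 0 := by positivity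
    apply mul_left_cancel₀ hm0
    rw [esymmTuple_newton, esymmTuple_newton]
    congr 1
    refine Finset.sum_congr rfl fun a ha => ?_
    have ha := Finset.mem_range.1 ha
    rw [ih a ha (by omega), h (m - a) (by omega) (by omega)]

/-- In generating functions, `∏ (1 + x i T) / ∏ (1 + y i T)` is the exponential of a series in the
differences of power sums. Only the difference of order `n` is present up to `T ^ (n + d)`, and `2 *
n > n + d`, so the quotient is `1 + g T ^ n` modulo `T ^ (n + d + 1)`. The proof runs this through
Newton's recursion. -/
theorem esymmTuple_sub_of_powerSums {k n d : ℕ} (hdn : d < n) {x y : Fin k → ℤ}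
    (h : ∀ j, 1 ≤ j → j ≤ n + d → j ≠ n → ∑ i, x i ^ j = ∑ i, y i ^ j) :
    ∀ m, m ≤ d → esymmTuple (n + m) x - esymmTuple (n + m) y =
      (esymmTuple n x - esymmTuple n y) * esymmTuple m y := by
  have hlow : ∀ m, m < n → esymmTuple m x = esymmTuple m y :=
    esymmTuple_eq_of_powerSums fun j h1 h2 => h j h1 (by omega) (by omega)
  set g := esymmTuple n x - esymmTuple n y with hg
  set Δ := ∑ i, x i ^ n - ∑ i, y i ^ n with hΔ
  have step : ∀ m, m ≤ d →
      (∀ t, t < m → esymmTuple (n + t) x - esymmTuple (n + t) y = g * esymmTuple t y) →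
      ((n + m : ℕ) : ℤ) * (esymmTuple (n + m) x - esymmTuple (n + m) y) =
        (-1) ^ (n + 1) * esymmTuple m y * Δ + g * ((m : ℤ) * esymmTuple m y) := by
    intro m hm ih
    rw [mul_sub, esymmTuple_newton, esymmTuple_newton, ← mul_sub, ← Finset.sum_sub_distrib,
      Finset.sum_range_add]
    -- Below `n` only `a = m` contributes, being paired with the power sum of order `n`.
    have h1 : ∑ a ∈ Finset.range n, ((-1) ^ a * esymmTuple a x * ∑ i, x i ^ (n + m - a) -
        (-1) ^ a * esymmTuple a y * ∑ i, y i ^ (n + m - a)) = (-1) ^ m * esymmTuple m y * Δ := by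
      rw [Finset.sum_eq_single m]
      · rw [hlow m (by omega), Nat.add_sub_cancel, hΔ]; ring
      · intro a ha ham
        have ha := Finset.mem_range.1 ha
        rw [hlow a ha, h (n + m - a) (by omega) (by omega) (by omega)]; ring
      · intro hmem
        exact absurd (Finset.mem_range.2 (by omega)) hmem
    have h2 : ∑ t ∈ Finset.range m, ((-1) ^ (n + t) * esymmTuple (n + t) x *
          ∑ i, x i ^ (n + m - (n + t)) -
        (-1) ^ (n + t) * esymmTuple (n + t) y * ∑ i, y i ^ (n + m - (n + t))) =
        (-1) ^ n * g * ∑ t ∈ Finset.range m, (-1) ^ t * esymmTuple t y * ∑ i, y i ^ (m - t) := by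
      rw [Finset.mul_sum]
      refine Finset.sum_congr rfl fun t ht => ?_
      have ht := Finset.mem_range.1 ht
      have e1 : n + m - (n + t) = m - t := by omega
      rw [e1, h (m - t) (by omega) (by omega) (by omega), ← sub_mul, ← mul_sub, ih t ht, pow_add]
      ring
    rw [h1, h2, esymmTuple_newton m y]
    have e2 : ((-1 : ℤ) ^ m) * (-1) ^ m = 1 := by rw [← mul_pow]; simp
    have e3 : ((-1 : ℤ) ^ n) * (-1) ^ n = 1 := by rw [← mul_pow]; simp
    rw [pow_add, pow_add, pow_add, pow_add, pow_one]
    linear_combination (-(-1) ^ n * esymmTuple m y * Δ) * e2 +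
      (-(-1) ^ m * g * ∑ t ∈ Finset.range m, (-1) ^ t * esymmTuple t y * ∑ i, y i ^ (m - t)) * e3
  have hn : (n : ℤ) * g = (-1) ^ (n + 1) * Δ := by
    have := step 0 (by omega) (fun t ht => absurd ht (by omega))
    simpa [esymmTuple_zero, hg] using this
  intro m
  induction m using Nat.strong_induction_on with
  | _ m ih =>
    intro hm
    have := step m hm (fun t ht => ih t ht (by omega))
    have hm0 : ((n + m : ℕ) : ℤ) ≠ 0 := by
      rw [Nat.cast_ne_zero]; omega
    apply mul_left_cancel₀ hm0
    rw [this]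
    push_cast
    linear_combination (-esymmTuple m y) * hn

/-- The monic polynomial of degree `d` with lower coefficients `E`. -/
def monicEval (d : ℕ) (E : ℕ → ℤ) (t : ℤ) : ℤ :=
  t ^ d + ∑ m ∈ Finset.range d, E m * t ^ (d - 1 - m)

/-- The first `d` non-leading coefficients of `∏ i, (t - y i)`. -/
def signedEsymm {k : ℕ} (y : Fin k → ℤ) (m : ℕ) : ℤ := (-1) ^ (m + 1) * esymmTuple (m + 1) y

theorem prod_sub_sub_prod_sub {k d : ℕ} (hd : 2 * d < k) {x y : Fin k → ℤ}
    (h : ∀ j, 1 ≤ j → j ≤ k → j + d ≠ k → ∑ i, x i ^ j = ∑ i, y i ^ j) (t : ℤ) :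
    ∏ i, (t - x i) - ∏ i, (t - y i) =
      (-1) ^ (k - d) * (esymmTuple (k - d) x - esymmTuple (k - d) y) *
        monicEval d (signedEsymm y) t := by
  obtain ⟨n, rfl⟩ : ∃ n, k = n + d := ⟨k - d, by omega⟩
  rw [Nat.add_sub_cancel]
  have hlow : ∀ m, m < n → esymmTuple m x = esymmTuple m y :=
    esymmTuple_eq_of_powerSums fun j h1 h2 => h j h1 (by omega) (by omega)
  have hhigh := esymmTuple_sub_of_powerSums (d := d) (n := n) (by omega) (x := x) (y := y)
    fun j h1 h2 h3 => h j h1 h2 (by omega)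
  rw [prod_sub_eq_sum_esymmTuple, prod_sub_eq_sum_esymmTuple, ← Finset.sum_sub_distrib, add_assoc,
    Finset.sum_range_add]
  rw [Finset.sum_eq_zero, zero_add, Finset.sum_range_succ']
  · rw [monicEval, add_comm (t ^ d), mul_add, Finset.mul_sum]
    congr 1
    · refine Finset.sum_congr rfl fun m hm => ?_
      have hm := Finset.mem_range.1 hm
      have e1 : n + d - (n + (m + 1)) = d - 1 - m := by omega
      rw [e1, ← sub_mul, ← mul_sub, hhigh (m + 1) (by omega), signedEsymm, pow_add]
      ring
    · simp only [add_zero, Nat.add_sub_cancel_left]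
      ring
  · intro a ha
    rw [hlow a (Finset.mem_range.1 ha), sub_self]

theorem abs_esymmTuple_le {k N : ℕ} (m : ℕ) {x : Fin k → ℤ} (hx : ∀ i, 1 ≤ x i ∧ x i ≤ N) :
    |esymmTuple m x| ≤ k.choose m * (N : ℤ) ^ m := by
  refine (Finset.abs_sum_le_sum_abs _ _).trans ?_
  have : ∀ t ∈ Finset.powersetCard m (Finset.univ : Finset (Fin k)), |∏ i ∈ t, x i| ≤ (N : ℤ) ^ m := by
    intro t ht
    rw [Finset.abs_prod, ← (Finset.mem_powersetCard.1 ht).2]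
    rw [← Finset.prod_const]
    refine Finset.prod_le_prod (fun i _ => abs_nonneg _) fun i _ => ?_
    rw [abs_of_nonneg (by have := (hx i).1; omega)]
    exact (hx i).2
  refine (Finset.sum_le_card_nsmul _ _ _ this).trans ?_
  simp

theorem exists_perm_of_prod_sub_eq {k : ℕ} {x y : Fin k → ℤ}
    (h : ∀ t, ∏ i, (t - x i) = ∏ i, (t - y i)) : ∃ σ : Equiv.Perm (Fin k), ∀ i, x i = y (σ i) := by
  have hp : ∏ i, (Polynomial.X - Polynomial.C (x i)) = ∏ i, (Polynomial.X - Polynomial.C (y i)) := by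
    apply Polynomial.funext
    intro t
    simpa [Polynomial.eval_prod] using h t
  have hr := congrArg Polynomial.roots hp
  have key : ∀ z : Fin k → ℤ, (∏ i, (Polynomial.X - Polynomial.C (z i))).roots =
      Multiset.map z Finset.univ.val := by
    intro z
    have := Polynomial.roots_multiset_prod_X_sub_C (Multiset.map z Finset.univ.val)
    rw [Multiset.map_map] at this
    exact this
  rw [key, key] at hr
  have hl : ∀ z : Fin k → ℤ, Multiset.map z Finset.univ.val = (List.ofFn z : Multiset ℤ) := by
    intro z
    rw [Fin.univ_val_map]
  rw [hl, hl, Multiset.coe_eq_coe] at hr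
  have hs : List.ofFn (x ∘ Tuple.sort x) = List.ofFn (y ∘ Tuple.sort y) :=
    (((Equiv.Perm.ofFn_comp_perm _ x).trans hr).trans
      (Equiv.Perm.ofFn_comp_perm _ y).symm).eq_of_pairwise'
      (Tuple.monotone_sort x).sortedLE_ofFn.pairwise (Tuple.monotone_sort y).sortedLE_ofFn.pairwise
  have hs := List.ofFn_injective hs
  refine ⟨(Tuple.sort x).symm.trans (Tuple.sort y), fun i => ?_⟩
  simpa using congrFun hs ((Tuple.sort x).symm i)

/-! ### Non-diagonal solutions and the factor `h`. -/

open Classical in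
/-- The non-diagonal solutions with entries in `[1, N]`. -/
noncomputable def offDiagonal (k d N : ℕ) : Finset ((Fin k → ℤ) × (Fin k → ℤ)) :=
  {s ∈ Fintype.piFinset (fun _ : Fin k => Finset.Icc (1 : ℤ) N) ×ˢ
      Fintype.piFinset (fun _ : Fin k => Finset.Icc (1 : ℤ) N) |
    (∀ j : ℕ, 1 ≤ j → j ≤ k → j + d ≠ k → ∑ i, s.1 i ^ j = ∑ i, s.2 i ^ j) ∧
      ¬ ∃ σ : Equiv.Perm (Fin k), ∀ i, s.1 i = s.2 (σ i)}

theorem mem_offDiagonal {k d N : ℕ} {s : (Fin k → ℤ) × (Fin k → ℤ)} :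
    s ∈ offDiagonal k d N ↔ ((∀ i, 1 ≤ s.1 i ∧ s.1 i ≤ N) ∧ ∀ i, 1 ≤ s.2 i ∧ s.2 i ≤ N) ∧
      (∀ j : ℕ, 1 ≤ j → j ≤ k → j + d ≠ k → ∑ i, s.1 i ^ j = ∑ i, s.2 i ^ j) ∧
      ¬ ∃ σ : Equiv.Perm (Fin k), ∀ i, s.1 i = s.2 (σ i) := by
  classical
  simp [offDiagonal, Fintype.mem_piFinset]

theorem abs_solutionCount_sub_diagonalCount (k d : ℕ) {X : ℝ} (hX : 1 ≤ X) :
    |(solutionCount k d X : ℝ) - (diagonalCount k X : ℝ)| = (offDiagonal k d ⌊X⌋₊).card := by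
  have hsub : diagonalSolutions k X ⊆ incompleteVinogradovSolutions k d X := by
    rintro p ⟨h1, σ, h2⟩
    refine ⟨h1, fun j _ _ _ => ?_⟩
    rw [← Equiv.sum_comp σ (fun i => p.2 i ^ j)]
    exact Finset.sum_congr rfl fun i _ => by rw [h2]
  have hfl : ∀ n : ℤ, 1 ≤ n → ((n : ℝ) ≤ X ↔ n ≤ ((⌊X⌋₊ : ℕ) : ℤ)) := by
    intro n _
    rw [← Int.floor_toNat, Int.toNat_of_nonneg (Int.floor_nonneg.2 (by linarith)), Int.le_floor]
  have heq : incompleteVinogradovSolutions k d X \ diagonalSolutions k X =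
      (offDiagonal k d ⌊X⌋₊ : Set _) := by
    ext p
    simp only [Set.mem_sdiff, incompleteVinogradovSolutions, diagonalSolutions, Set.mem_ofPred_eq,
      Finset.mem_coe, mem_offDiagonal]
    constructor
    · rintro ⟨⟨h1, h2⟩, h3⟩
      exact ⟨⟨fun i => ⟨(h1 i).1.1, (hfl _ (h1 i).1.1).1 (h1 i).1.2⟩,
        fun i => ⟨(h1 i).2.1, (hfl _ (h1 i).2.1).1 (h1 i).2.2⟩⟩, h2, fun hσ => h3 ⟨h1, hσ⟩⟩
    · rintro ⟨⟨h1, h1'⟩, h2, h3⟩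
      exact ⟨⟨fun i => ⟨⟨(h1 i).1, (hfl _ (h1 i).1).2 (h1 i).2⟩,
        ⟨(h1' i).1, (hfl _ (h1' i).1).2 (h1' i).2⟩⟩, h2⟩, fun h => h3 h.2⟩
  have hcard := Set.ncard_sdiff_add_ncard_of_subset hsub (incompleteVinogradovSolutions_finite k d X)
  rw [heq, Set.ncard_coe_finset] at hcard
  rw [solutionCount, diagonalCount, ← hcard]
  push_cast
  rw [add_sub_cancel_right, abs_of_nonneg (Nat.cast_nonneg _)]

/-- The factor `h` in `∏ i, (t - x i) - ∏ i, (t - y i) = h * q t`. -/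
def leadDiff {k : ℕ} (d : ℕ) (s : (Fin k → ℤ) × (Fin k → ℤ)) : ℤ :=
  (-1) ^ (k - d) * (esymmTuple (k - d) s.1 - esymmTuple (k - d) s.2)

section
variable {k d N : ℕ} {s : (Fin k → ℤ) × (Fin k → ℤ)}

theorem prod_sub_sub_prod_sub_of_mem (hd : 2 * d < k) (hs : s ∈ offDiagonal k d N) (t : ℤ) :
    ∏ i, (t - s.1 i) - ∏ i, (t - s.2 i) =
      leadDiff d s * monicEval d (signedEsymm s.2) t :=
  prod_sub_sub_prod_sub hd (mem_offDiagonal.1 hs).2.1 t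

/-- If `h = 0` the two polynomials coincide, and `x` is a permutation of `y`. -/
theorem leadDiff_ne_zero (hd : 2 * d < k) (hs : s ∈ offDiagonal k d N) : leadDiff d s ≠ 0 := by
  intro h0
  refine (mem_offDiagonal.1 hs).2.2 (exists_perm_of_prod_sub_eq fun t => ?_)
  have := prod_sub_sub_prod_sub_of_mem hd hs t
  rw [h0, zero_mul] at this
  linarith

theorem abs_esymmTuple_le_two_pow_mul {x : Fin k → ℤ} (m : ℕ) (hx : ∀ i, 1 ≤ x i ∧ x i ≤ N) :
    |esymmTuple m x| ≤ 2 ^ k * (N : ℤ) ^ m := by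
  refine (abs_esymmTuple_le m hx).trans ?_
  gcongr
  exact_mod_cast Nat.choose_le_two_pow k m

theorem natAbs_leadDiff_le (hs : s ∈ offDiagonal k d N) :
    (leadDiff d s).natAbs ≤ 2 ^ (k + 1) * N ^ (k - d) := by
  have h := (mem_offDiagonal.1 hs).1
  have h1 := abs_esymmTuple_le_two_pow_mul (k - d) h.1
  have h2 := abs_esymmTuple_le_two_pow_mul (k - d) h.2
  zify
  rw [leadDiff, abs_mul, abs_pow, abs_neg, abs_one, one_pow, one_mul]
  refine (abs_sub _ _).trans ?_
  rw [pow_succ]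
  linarith

end

/-- Polynomials with integral roots and the same values agree up to reordering the roots. -/
theorem tuple_eq_of_prod_sub_eq {k : ℕ} {y y' : Fin k → ℤ}
    (h : ∀ t, ∏ i, (t - y i) = ∏ i, (t - y' i)) (hsort : Tuple.sort y = Tuple.sort y') :
    y = y' := by
  obtain ⟨ρ, hρ⟩ := exists_perm_of_prod_sub_eq h
  have h1 : Monotone (y' ∘ ((Tuple.sort y').trans ρ)) := by
    have := Tuple.monotone_sort y
    rw [hsort] at this
    intro a b hab
    simpa [hρ] using this hab
  have h2 := Tuple.unique_monotone h1 (Tuple.monotone_sort y')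
  funext i
  have := congrFun h2 ((Tuple.sort y').symm i)
  simpa [hρ] using this

/-! ### The refinement attached to a solution. -/

/-- `α` refines the factorisations `x i - z j = (divisor of q j) * (factor of H)`. -/
structure IsRefinement {k R : ℕ} (x : Fin k → ℤ) (z : Fin R → ℤ) (q : Fin R → ℤ) (H : ℕ)
    (α : (Fin R → Fin k) → ℕ) : Prop where
  prod_eq : ∏ f, α f = H
  ne : ∀ i j, x i ≠ z j
  cell : ∀ i j, ∃ w, w ∣ (q j).natAbs ∧ (x i - z j).natAbs = w * ∏ f with f j = i, α f

/-- Since `h` divides `∏ i, (z j - x i)`, its absolute value splits over the factors; the cofactors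
`w i` multiply to `|q j|`, so each divides it. -/
theorem exists_isRefinement {k R : ℕ} {x : Fin k → ℤ} {z q : Fin R → ℤ} {h : ℤ} (hh : h ≠ 0)
    (hq : ∀ j, q j ≠ 0) (hprod : ∀ j, ∏ i, (z j - x i) = h * q j) :
    ∃ α, IsRefinement x z q h.natAbs α := by
  have hu : ∀ j, ∏ i, (x i - z j).natAbs = h.natAbs * (q j).natAbs := by
    intro j
    rw [← Int.natAbs_mul, ← hprod j]
    have : ∀ i, (x i - z j).natAbs = Int.natAbsHom (z j - x i) := fun i => by
      rw [Int.natAbsHom_apply]; omega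
    simp_rw [this, ← map_prod]
    rfl
  have hH : h.natAbs ≠ 0 := Int.natAbs_ne_zero.2 hh
  have hv : ∀ j, ∃ v : Fin k → ℕ, (∀ i, v i ∣ (x i - z j).natAbs) ∧ ∏ i, v i = h.natAbs :=
    fun j => exists_dvd_prod_eq Finset.univ (fun i => (x i - z j).natAbs) h.natAbs
      ((hu j).symm ▸ dvd_mul_right _ _)
  choose v hv1 hv2 using hv
  obtain ⟨α, hα1, hα2⟩ := exists_refinement hH R (fun i j => v j i) hv2
  refine ⟨α, hα1, fun i j hij => ?_, fun i j => ?_⟩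
  · have := hprod j
    rw [Finset.prod_eq_zero (Finset.mem_univ i) (by rw [hij, sub_self])] at this
    exact mul_ne_zero hh (hq j) this.symm
  · choose w hw using hv1 j
    refine ⟨w i, ?_, by rw [hα2, hw, mul_comm]⟩
    have h1 := hu j
    simp_rw [hw, Finset.prod_mul_distrib, hv2] at h1
    rw [← Nat.eq_of_mul_eq_mul_left (Nat.pos_of_ne_zero hH) h1]
    exact Finset.dvd_prod_of_mem w (Finset.mem_univ i)

namespace IsRefinement
variable {k R : ℕ} {x : Fin k → ℤ} {z q : Fin R → ℤ} {H : ℕ} {α : (Fin R → Fin k) → ℕ}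

theorem natAbs_ne (h : IsRefinement x z q H α) (i : Fin k) (j : Fin R) :
    (x i - z j).natAbs ≠ 0 := Int.natAbs_ne_zero.2 (sub_ne_zero.2 (h.ne i j))

theorem dvd (h : IsRefinement x z q H α) {f : Fin R → Fin k} {i : Fin k} {j : Fin R}
    (hf : f j = i) : α f ∣ (x i - z j).natAbs := by
  obtain ⟨w, -, hw⟩ := h.cell i j
  rw [hw]
  exact (Finset.dvd_prod_of_mem α (by simp [hf])).mul_left _

theorem ne_zero (h : IsRefinement x z q H α) (j : Fin R) (f : Fin R → Fin k) : α f ≠ 0 :=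
  ne_zero_of_dvd_ne_zero (h.natAbs_ne (f j) j) (h.dvd rfl)

/-- Ties are harmless: when `f` takes the same row in columns `l` and `j`, that row's `x` cancels,
and `α f` divides a difference of the `z`'s alone. -/
theorem dvd_sub (h : IsRefinement x z q H α) {f : Fin R → Fin k} {j l : Fin R}
    (hf : f l = f j) : α f ∣ (z l - z j).natAbs := by
  have h1 := Int.natCast_dvd.2 (h.dvd (f := f) (i := f j) rfl (j := j))
  have h2 := Int.natCast_dvd.2 (h.dvd hf)
  apply Int.natCast_dvd.1
  have := h1.sub h2
  rwa [sub_sub_sub_cancel_left] at this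

end IsRefinement

/-! ### Recovering `x` row by row. -/

/-- The multi-indices whose `p`-th entry comes strictly first in the order given by `π`. -/
def strictMinIndices {k R : ℕ} (π : Equiv.Perm (Fin k)) (p : Fin R) : Finset (Fin R → Fin k) :=
  {f | ∀ l, l ≠ p → π (f p) < π (f l)}

theorem pairwiseDisjoint_strictMinIndices {k R : ℕ} (π : Equiv.Perm (Fin k)) (A : Set (Fin R)) :
    A.PairwiseDisjoint (strictMinIndices π) := by
  intro p _ p' _ hpp
  refine Finset.disjoint_left.2 fun f hf hf' => ?_
  simp only [strictMinIndices, Finset.mem_filter, Finset.mem_univ, true_and] at hf hf'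
  exact lt_asymm (hf p' hpp.symm) (hf' p hpp)

open Classical in
/-- A multiple of `α f`, given by `P` and by those `x i` for which `i` precedes `f p`. -/
noncomputable def knownMultiple {k R : ℕ} (π : Equiv.Perm (Fin k)) (p : Fin R) (P : ℕ)
    (z : Fin R → ℤ) (x : Fin k → ℤ) (f : Fin R → Fin k) : ℕ :=
  if h : ∃ l, l ≠ p ∧ π (f l) ≤ π (f p) then
    if f h.choose = f p then (z h.choose - z p).natAbs else (x (f h.choose) - z h.choose).natAbs
  else P

section
variable {k R : ℕ} {π : Equiv.Perm (Fin k)} {p : Fin R} {z : Fin R → ℤ}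

theorem knownMultiple_congr {P : ℕ} {x x' : Fin k → ℤ} {f : Fin R → Fin k}
    (h : ∀ i, π i < π (f p) → x i = x' i) :
    knownMultiple π p P z x f = knownMultiple π p P z x' f := by
  rw [knownMultiple, knownMultiple]
  split_ifs with h1 h2
  · rfl
  · rw [h]
    exact lt_of_le_of_ne h1.choose_spec.2 fun h => h2 (π.injective h)
  · rfl

/-- If some `l ≠ p` has `f l` not after `f p`, then either `f l = f p` and `α f` divides `z l - z
p`, or row `f l` is already known and `α f` divides `x (f l) - z l`. Otherwise `f` is a strict
minimum at `p`, and `α f` is a factor of the product. -/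
theorem dvd_knownMultiple {x : Fin k → ℤ} {q : Fin R → ℤ} {H : ℕ}
    {α : (Fin R → Fin k) → ℕ} (hα : IsRefinement x z q H α) (f : Fin R → Fin k) :
    α f ∣ knownMultiple π p (∏ g ∈ strictMinIndices π p, α g) z x f := by
  rw [knownMultiple]
  split_ifs with h1 h2
  · exact hα.dvd_sub h2
  · exact hα.dvd rfl
  · refine Finset.dvd_prod_of_mem α ?_
    push Not at h1
    simpa [strictMinIndices] using h1

theorem knownMultiple_ne_zero {P : ℕ} (hP : P ≠ 0) (hz : Function.Injective z) {x : Fin k → ℤ}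
    (hx : ∀ i j, x i ≠ z j) (f : Fin R → Fin k) : knownMultiple π p P z x f ≠ 0 := by
  rw [knownMultiple]
  split_ifs with h1 h2
  · exact Int.natAbs_ne_zero.2 (sub_ne_zero.2 fun h => h1.choose_spec.1 (hz h))
  · exact Int.natAbs_ne_zero.2 (sub_ne_zero.2 (hx _ _))
  · exact hP

theorem knownMultiple_le {P N : ℕ} {x : Fin k → ℤ} (hx : ∀ i, 1 ≤ x i ∧ x i ≤ N)
    (hz : ∀ j, 1 ≤ z j ∧ z j ≤ N) (f : Fin R → Fin k) :
    knownMultiple π p P z x f ≤ max P N := by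
  rw [knownMultiple]
  split_ifs with h1 h2
  · have h3 := hz h1.choose
    have h4 := hz p
    exact le_max_of_le_right (by omega)
  · have h3 := hz h1.choose
    have h4 := hx (f h1.choose)
    exact le_max_of_le_right (by omega)
  · exact le_max_left _ _

theorem eq_of_natAbs_eq_of_lt_iff {a b c : ℤ} (h : (a - c).natAbs = (b - c).natAbs)
    (hlt : a < c ↔ b < c) : a = b := by omega

/-- The `x i` are determined, one after the other in the order `π`, by the product over
`strictMinIndices π p` and the positions of the `α f` and `w i` among the divisors of numbers
that are already known. -/
theorem eq_of_divisorIndex_eq (hz : Function.Injective z) {x x' : Fin k → ℤ}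
    {q q' : Fin R → ℤ} {H H' : ℕ} {α α' : (Fin R → Fin k) → ℕ}
    (hα : IsRefinement x z q H α) (hα' : IsRefinement x' z q' H' α') {P : ℕ}
    (hP : ∏ g ∈ strictMinIndices π p, α g = P) (hP' : ∏ g ∈ strictMinIndices π p, α' g = P)
    {Q : ℕ} (hQ : Q ≠ 0) {w w' : Fin k → ℕ} (hw : ∀ i, w i ∣ Q) (hw' : ∀ i, w' i ∣ Q)
    (hxw : ∀ i, (x i - z p).natAbs = w i * ∏ f with f p = i, α f)
    (hxw' : ∀ i, (x' i - z p).natAbs = w' i * ∏ f with f p = i, α' f)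
    (hc : ∀ f, divisorIndex (knownMultiple π p P z x f) (α f) =
      divisorIndex (knownMultiple π p P z x' f) (α' f))
    (hcw : ∀ i, divisorIndex Q (w i) = divisorIndex Q (w' i))
    (hs : ∀ i, x i < z p ↔ x' i < z p) : x = x' := by
  have hP0 : P ≠ 0 := by
    rw [← hP]; exact Finset.prod_ne_zero_iff.2 fun f _ => hα.ne_zero p f
  have main : ∀ n : ℕ, ∀ i, (π i : ℕ) = n → x i = x' i := by
    intro n
    induction n using Nat.strong_induction_on with
    | _ n ih =>
      intro i hi
      have hα_eq : ∀ f, f p = i → α f = α' f := by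
        intro f hf
        have hk : knownMultiple π p P z x f = knownMultiple π p P z x' f :=
          knownMultiple_congr fun a ha => ih _ (by rw [← hi, ← hf]; exact ha) a rfl
        refine divisorIndex_injOn (knownMultiple_ne_zero (π := π) (p := p) hP0 hz hα.ne f)
          (hP ▸ dvd_knownMultiple hα f) ?_ ((hc f).trans (by rw [hk]))
        rw [hk]
        exact hP' ▸ dvd_knownMultiple hα' f
      have hw_eq : w i = w' i := divisorIndex_injOn hQ (hw i) (hw' i) (hcw i)
      refine eq_of_natAbs_eq_of_lt_iff ?_ (hs i)
      rw [hxw, hxw', hw_eq]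
      congr 1
      exact Finset.prod_congr rfl fun f hf => hα_eq f (Finset.mem_filter.1 hf).2
  exact funext fun i => main _ i rfl

end

/-! ### Counting solutions with a small exceptional product. -/

theorem monicEval_congr {d : ℕ} {E E' : ℕ → ℤ} (h : ∀ m : Fin d, E m = E' m) (t : ℤ) :
    monicEval d E t = monicEval d E' t := by
  rw [monicEval, monicEval]
  congr 1
  exact Finset.sum_congr rfl fun m hm => by rw [h ⟨m, Finset.mem_range.1 hm⟩]

theorem natAbs_monicEval_le {k d N : ℕ} (hd : d ≤ k) (hN : 1 ≤ N) {y : Fin k → ℤ}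
    (hy : ∀ i, 1 ≤ y i ∧ y i ≤ N) {t : ℤ} (ht : 1 ≤ t ∧ t ≤ N) :
    (monicEval d (signedEsymm y) t).natAbs ≤ (1 + d * 2 ^ k) * N ^ k := by
  have hN' : (1 : ℤ) ≤ N := by exact_mod_cast hN
  have htp : ∀ m : ℕ, |t ^ m| ≤ (N : ℤ) ^ m := fun m => by
    rw [abs_pow, abs_of_nonneg (by omega)]
    exact pow_le_pow_left₀ (by omega) ht.2 m
  zify
  rw [monicEval, one_add_mul]
  refine (abs_add_le _ _).trans (add_le_add ?_ ?_)
  · exact (htp d).trans (pow_le_pow_right₀ hN' hd)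
  · refine (Finset.abs_sum_le_sum_abs _ _).trans ?_
    rw [mul_assoc]
    refine (Finset.sum_le_card_nsmul _ _ (2 ^ k * (N : ℤ) ^ k) fun m hm => ?_).trans (by simp)
    have hm := Finset.mem_range.1 hm
    rw [abs_mul, signedEsymm, abs_mul, abs_pow, abs_neg, abs_one, one_pow, one_mul]
    calc _ ≤ 2 ^ k * (N : ℤ) ^ (m + 1) * (N : ℤ) ^ (d - 1 - m) := by
          gcongr
          · exact abs_esymmTuple_le_two_pow_mul _ hy
          · exact htp _
      _ = 2 ^ k * (N : ℤ) ^ d := by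
          rw [mul_assoc, ← pow_add]; congr 2; omega
      _ ≤ _ := by gcongr

/-- The coefficient of `q` of index `m` is an elementary symmetric polynomial of degree `m + 1`, so
the exponents add to `1 + ⋯ + d`; this is the source of `d(d+1)/2`. -/
theorem card_piFinset_Icc_le {k d N : ℕ} (hN : 1 ≤ N) :
    (Fintype.piFinset fun m : Fin d =>
      Finset.Icc (-(2 ^ k * (N : ℤ) ^ ((m : ℕ) + 1))) (2 ^ k * (N : ℤ) ^ ((m : ℕ) + 1))).card ≤
      (2 ^ (k + 2)) ^ d * N ^ (d * (d + 1) / 2) := by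
  rw [Fintype.card_piFinset]
  have : ∀ m : Fin d, (Finset.Icc (-(2 ^ k * (N : ℤ) ^ ((m : ℕ) + 1)))
      (2 ^ k * (N : ℤ) ^ ((m : ℕ) + 1))).card ≤ 2 ^ (k + 2) * N ^ ((m : ℕ) + 1) := by
    intro m
    rw [Int.card_Icc, Int.toNat_le]
    push_cast
    have h1 : (1 : ℤ) ≤ 2 ^ k * (N : ℤ) ^ ((m : ℕ) + 1) := by
      have : 0 < 2 ^ k * N ^ ((m : ℕ) + 1) := by positivity
      exact_mod_cast this
    have h2 : (2 : ℤ) ^ (k + 2) = 2 ^ k * 4 := by ring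
    rw [h2]
    linarith
  refine (Finset.prod_le_prod' fun m _ => this m).trans_eq ?_
  rw [Finset.prod_mul_distrib, Finset.prod_const, Finset.card_univ, Fintype.card_fin,
    Finset.prod_pow_eq_pow_sum, Fin.sum_univ_eq_sum_range (fun m => m + 1) d]
  congr 2
  have := Finset.sum_range_id_mul_two (d + 1)
  rw [Finset.sum_range_succ', add_zero, Nat.add_sub_cancel, mul_comm (d + 1)] at this
  omega

/-- Solutions for which some ordering of the rows makes one of the products over
`strictMinIndices` at most `Q`. -/
theorem exists_card_le_of_strictMinIndices (k d R : ℕ) (hd : 2 * d < k) {ε : ℝ} (hε : 0 < ε) :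
    ∃ C : ℝ, 0 < C ∧ ∀ N : ℕ, 1 ≤ N → ∀ Q : ℕ, ∀ S ⊆ offDiagonal k d N,
      (∀ s ∈ S, ∃ (σ : Fin R → Fin k) (π : Equiv.Perm (Fin k)) (p : Fin R)
        (α : (Fin R → Fin k) → ℕ), Function.Injective (s.2 ∘ σ) ∧
        (∀ j, monicEval d (signedEsymm s.2) (s.2 (σ j)) ≠ 0) ∧
        IsRefinement s.1 (s.2 ∘ σ) (fun j => monicEval d (signedEsymm s.2) (s.2 (σ j)))
          (leadDiff d s).natAbs α ∧ ∏ f ∈ strictMinIndices π p, α f ≤ Q) →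
      (S.card : ℝ) ≤ C * (N : ℝ) ^ ε * (N : ℝ) ^ (R + d * (d + 1) / 2) * Q := by
  classical
  -- The number of divisor labels: one for each `α f` and one for each cofactor `w i`. Each may cost
  -- `N ^ (ε / (n + 1))`.
  set n := Fintype.card (Fin R → Fin k) + k with hn
  obtain ⟨C₀, hC₀, hdiv⟩ := exists_card_divisors_le_of_le_pow (ε := ε / (n + 1)) (by positivity)
    (2 ^ (k + 1) + (1 + d * 2 ^ k)) k
  set L := Fintype.card ((Fin R → Fin k) × Equiv.Perm (Fin k) × Fin R × (Fin k → Bool) ×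
    Equiv.Perm (Fin k)) with hL
  refine ⟨(L + 1) * (2 ^ (k + 2)) ^ d * C₀ ^ n, by positivity, fun N hN Q S hS hgood => ?_⟩
  have hN1 : (1 : ℝ) ≤ N := by exact_mod_cast hN
  set M := ⌊C₀ * (N : ℝ) ^ (ε / (n + 1))⌋₊ with hM
  have hdivM : ∀ m : ℕ, m ≠ 0 → m ≤ (2 ^ (k + 1) + (1 + d * 2 ^ k)) * N ^ k →
      m.divisors.card ≤ M := fun m h1 h2 => Nat.le_floor (hdiv N hN m h1 h2)
  have hgood' : ∀ s : S, ∃ (σ : Fin R → Fin k) (π : Equiv.Perm (Fin k)) (p : Fin R)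
        (α : (Fin R → Fin k) → ℕ), Function.Injective (s.1.2 ∘ σ) ∧
        (∀ j, monicEval d (signedEsymm s.1.2) (s.1.2 (σ j)) ≠ 0) ∧
        IsRefinement s.1.1 (s.1.2 ∘ σ) (fun j => monicEval d (signedEsymm s.1.2) (s.1.2 (σ j)))
          (leadDiff d s.1).natAbs α ∧ ∏ f ∈ strictMinIndices π p, α f ≤ Q :=
    fun s => hgood s.1 s.2
  choose σ π p α hinj hq hα hQ using hgood'
  choose w hw1 hw2 using fun s i => (hα s).cell i (p s)
  have hbox := fun s : S => (mem_offDiagonal.1 (hS s.2)).1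
  let P : S → ℕ := fun s => ∏ f ∈ strictMinIndices (π s) (p s), α s f
  have hP0 : ∀ s, P s ≠ 0 := fun s =>
    Finset.prod_ne_zero_iff.2 fun f _ => (hα s).ne_zero (p s) f
  have hNk : N ≤ N ^ k := Nat.le_self_pow (by omega) N
  have hPle : ∀ s, P s ≤ 2 ^ (k + 1) * N ^ k := by
    intro s
    have h1 : P s ∣ (leadDiff d s.1).natAbs := by
      rw [← (hα s).prod_eq]
      exact Finset.prod_dvd_prod_of_subset _ _ _ (Finset.subset_univ _)
    refine (Nat.le_of_dvd (Nat.pos_of_ne_zero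
      (Int.natAbs_ne_zero.2 (leadDiff_ne_zero hd (hS s.2)))) h1).trans ?_
    refine (natAbs_leadDiff_le (hS s.2)).trans ?_
    gcongr
    omega
  let T := (Finset.univ : Finset ((Fin R → Fin k) × Equiv.Perm (Fin k) × Fin R × (Fin k → Bool) ×
      Equiv.Perm (Fin k))) ×ˢ
    (Fintype.piFinset fun _ : Fin R => Finset.Icc (1 : ℤ) N) ×ˢ
    (Fintype.piFinset fun m : Fin d =>
      Finset.Icc (-(2 ^ k * (N : ℤ) ^ ((m : ℕ) + 1))) (2 ^ k * (N : ℤ) ^ ((m : ℕ) + 1))) ×ˢ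
    Finset.Icc 1 Q ×ˢ
    (Fintype.piFinset fun _ : Fin R → Fin k => Finset.range M) ×ˢ
    (Fintype.piFinset fun _ : Fin k => Finset.range M)
  let enc : S → ((Fin R → Fin k) × Equiv.Perm (Fin k) × Fin R × (Fin k → Bool) ×
      Equiv.Perm (Fin k)) × (Fin R → ℤ) × (Fin d → ℤ) × ℕ × ((Fin R → Fin k) → ℕ) × (Fin k → ℕ) :=
    fun s => ((σ s, π s, p s, fun i => decide (s.1.1 i < s.1.2 (σ s (p s))),
        Tuple.sort s.1.2), s.1.2 ∘ σ s, fun m => signedEsymm s.1.2 m, P s,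
      fun f => divisorIndex (knownMultiple (π s) (p s) (P s) (s.1.2 ∘ σ s) s.1.1 f) (α s f),
      fun i => divisorIndex (monicEval d (signedEsymm s.1.2) (s.1.2 (σ s (p s)))).natAbs (w s i))
  have hcard : (Finset.univ : Finset S).card ≤ T.card := by
    refine Finset.card_le_card_of_injOn enc (fun s _ => ?_) (fun s _ s' _ hss => ?_)
    · have hb := hbox s
      simp only [T, enc, Finset.coe_product, Set.mem_prod, Finset.mem_coe, Finset.mem_univ,
        Fintype.mem_piFinset, Finset.mem_Icc, Finset.mem_range, true_and, Function.comp_apply]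
      refine ⟨fun j => hb.2 _, fun m => ?_, ⟨Nat.pos_of_ne_zero (hP0 s), hQ s⟩, fun f => ?_,
        fun i => ?_⟩
      · rw [← abs_le, signedEsymm, abs_mul, abs_pow, abs_neg, abs_one, one_pow, one_mul]
        exact abs_esymmTuple_le_two_pow_mul _ hb.2
      · have hk0 := knownMultiple_ne_zero (π := π s) (p := p s) (hP0 s) (hinj s) (hα s).ne f
        refine (divisorIndex_lt hk0 (dvd_knownMultiple (hα s) f)).trans_le (hdivM _ hk0 ?_)
        refine (knownMultiple_le hb.1 (fun j => hb.2 _) f).trans (max_le ?_ ?_)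
        · exact (hPle s).trans (Nat.mul_le_mul_right _ (Nat.le_add_right _ _))
        · exact hNk.trans (Nat.le_mul_of_pos_left _ (by positivity))
      · have hk0 := Int.natAbs_ne_zero.2 (hq s (p s))
        refine (divisorIndex_lt hk0 (hw1 s i)).trans_le (hdivM _ hk0 ?_)
        exact (natAbs_monicEval_le (by omega) hN hb.2 (hb.2 _)).trans
          (Nat.mul_le_mul_right _ (Nat.le_add_left _ _))
    · simp only [enc, Prod.mk.injEq] at hss
      obtain ⟨⟨-, hπ, hp, hs, hsort⟩, hz, hE, hP, hc, hcw⟩ := hss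
      have hE' : ∀ t, monicEval d (signedEsymm s.1.2) t = monicEval d (signedEsymm s'.1.2) t :=
        monicEval_congr fun m => congrFun hE m
      have hzp : s.1.2 (σ s (p s)) = s'.1.2 (σ s' (p s')) := by
        rw [hp]; exact congrFun hz (p s')
      have hx : s.1.1 = s'.1.1 := by
        have hα' := hα s'
        have hw2' := hw2 s'
        have hP' : ∏ g ∈ strictMinIndices (π s') (p s'), α s' g = P s' := rfl
        have hw1' := hw1 s'
        simp only [← hE', ← hzp] at hcw hw1'
        have hs' := fun i => decide_eq_decide.1 (congrFun hs i)
        have hc' := congrFun hc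
        rw [← hzp] at hs'
        simp only [← hz, ← hπ, ← hp, ← hP] at hα' hw2' hP' hc'
        exact eq_of_divisorIndex_eq (hinj s) (hα s) hα' rfl hP' (Int.natAbs_ne_zero.2 (hq s (p s)))
          (hw1 s) hw1' (hw2 s) hw2' hc' (congrFun hcw) hs'
      have hid := prod_sub_sub_prod_sub_of_mem hd (hS s.2)
      have hid' := prod_sub_sub_prod_sub_of_mem hd (hS s'.2)
      -- Once `x` and `q` are known, `t = z p` gives `h`, as `q (z p) ≠ 0`. The identity then gives
      -- `∏ (t - y i)`, and the sorting permutation gives the order of the entries.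
      have hlead : leadDiff d s.1 = leadDiff d s'.1 := by
        have h1 := hid (s.1.2 (σ s (p s)))
        have h2 := hid' (s'.1.2 (σ s' (p s')))
        rw [Finset.prod_eq_zero (f := fun i => s.1.2 (σ s (p s)) - s.1.2 i)
          (Finset.mem_univ (σ s (p s))) (sub_self _), sub_zero] at h1
        rw [Finset.prod_eq_zero (f := fun i => s'.1.2 (σ s' (p s')) - s'.1.2 i)
          (Finset.mem_univ (σ s' (p s'))) (sub_self _), sub_zero, ← hzp, ← hx, h1, hE'] at h2
        exact mul_right_cancel₀ (hE' _ ▸ hq s (p s)) h2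
      have hy : s.1.2 = s'.1.2 := by
        refine tuple_eq_of_prod_sub_eq (fun t => ?_) hsort
        have h1 := hid t
        have h2 := hid' t
        rw [← hx, ← hlead, ← hE'] at h2
        linarith
      exact Subtype.ext (Prod.ext hx hy)
  have hM' : (M : ℝ) ≤ C₀ * (N : ℝ) ^ (ε / (n + 1)) := Nat.floor_le (by positivity)
  have hMn : (M : ℝ) ^ n ≤ C₀ ^ n * (N : ℝ) ^ ε := by
    refine (pow_le_pow_left₀ M.cast_nonneg hM' n).trans ?_
    rw [mul_pow, ← Real.rpow_natCast ((N : ℝ) ^ _) n, ← Real.rpow_mul (by positivity)]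
    gcongr
    rw [div_mul_eq_mul_div, div_le_iff₀ (by positivity)]
    nlinarith
  have hTcard : T.card ≤ L * (N ^ R * ((2 ^ (k + 2)) ^ d * N ^ (d * (d + 1) / 2) * (Q *
      M ^ n))) := by
    have hE := card_piFinset_Icc_le (k := k) (d := d) hN
    simp only [T, Finset.card_product]
    refine Nat.mul_le_mul (by simp [hL]) (Nat.mul_le_mul (by simp [Fintype.card_piFinset])
      (Nat.mul_le_mul hE (Nat.mul_le_mul (by simp) ?_)))
    simp [Fintype.card_piFinset, hn, pow_add]
  rw [Finset.card_univ, Fintype.card_coe] at hcard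
  have hfin : (S.card : ℝ) ≤ L * ((N : ℝ) ^ R * ((2 ^ (k + 2)) ^ d *
      (N : ℝ) ^ (d * (d + 1) / 2) * (Q * (M : ℝ) ^ n))) := by exact_mod_cast hcard.trans hTcard
  refine hfin.trans ?_
  calc (L : ℝ) * ((N : ℝ) ^ R * ((2 ^ (k + 2)) ^ d * (N : ℝ) ^ (d * (d + 1) / 2) *
        (Q * (M : ℝ) ^ n)))
      ≤ (L + 1) * ((N : ℝ) ^ R * ((2 ^ (k + 2)) ^ d * (N : ℝ) ^ (d * (d + 1) / 2) *
        (Q * (C₀ ^ n * (N : ℝ) ^ ε)))) := by gcongr; linarith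
    _ = _ := by rw [pow_add]; ring

/-! ### Trivial bounds, and few distinct entries. -/

theorem card_offDiagonal_le (k d N : ℕ) : (offDiagonal k d N).card ≤ N ^ (2 * k) := by
  refine (Finset.card_filter_le _ _).trans_eq ?_
  simp [Finset.card_product, Fintype.card_piFinset, two_mul, pow_add]

/-- The condition `d ≠ k` keeps the linear equation in the system, and that equation determines `x
0`. -/
theorem card_offDiagonal_succ_le {k d N : ℕ} (hkd : d ≠ k) :
    (offDiagonal (k + 1) d N).card ≤ N ^ (2 * k + 1) := by
  have : (offDiagonal (k + 1) d N).card ≤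
      ((Fintype.piFinset fun _ : Fin k => Finset.Icc (1 : ℤ) N) ×ˢ
        (Fintype.piFinset fun _ : Fin (k + 1) => Finset.Icc (1 : ℤ) N)).card := by
    refine Finset.card_le_card_of_injOn (fun s => (Fin.tail s.1, s.2)) (fun s hs => ?_)
      (fun s hs s' hs' h => ?_)
    · have hb := (mem_offDiagonal.1 hs).1
      simp only [Finset.coe_product, Set.mem_prod, Finset.mem_coe, Fintype.mem_piFinset,
        Finset.mem_Icc]
      exact ⟨fun i => hb.1 _, fun i => hb.2 i⟩
    · simp only [Prod.mk.injEq] at h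
      have h1 := (mem_offDiagonal.1 hs).2.1 1 le_rfl (by omega) (by omega)
      have h2 := (mem_offDiagonal.1 hs').2.1 1 le_rfl (by omega) (by omega)
      simp only [pow_one] at h1 h2
      rw [Fin.sum_univ_succ] at h1 h2
      have ht : ∀ i : Fin k, s.1 i.succ = s'.1 i.succ := fun i => congrFun h.1 i
      refine Prod.ext (funext fun i => Fin.cases ?_ ht i) h.2
      rw [← h.2, ← h1] at h2
      simp_rw [ht] at h2
      linarith
  refine this.trans_eq ?_
  rw [Finset.card_product, Fintype.card_piFinset, Fintype.card_piFinset]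
  simp only [Int.card_Icc, add_sub_cancel_right, Int.toNat_natCast, Finset.prod_const,
    Finset.card_univ, Fintype.card_fin, ← pow_add]
  congr 1
  ring

theorem card_roots_monicEval_le (d : ℕ) (E : ℕ → ℤ) (A : Finset ℤ)
    (hA : ∀ t ∈ A, monicEval d E t = 0) : A.card ≤ d := by
  set p : Polynomial ℤ := Polynomial.X ^ d +
    ∑ m ∈ Finset.range d, Polynomial.C (E m) * Polynomial.X ^ (d - 1 - m) with hp
  have hdeg : (∑ m ∈ Finset.range d, Polynomial.C (E m) * Polynomial.X ^ (d - 1 - m)).degree <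
      (d : WithBot ℕ) := by
    rcases Nat.eq_zero_or_pos d with rfl | hd
    · simp
    refine (Polynomial.degree_sum_le _ _).trans_lt ((Finset.sup_lt_iff (WithBot.bot_lt_coe d)).2 ?_)
    intro m hm
    refine (Polynomial.degree_C_mul_X_pow_le _ _).trans_lt ?_
    have := Finset.mem_range.1 hm
    exact WithBot.coe_lt_coe.2 (by omega : d - 1 - m < d)
  have hmonic : p.Monic := Polynomial.monic_X_pow_add hdeg
  have hnat : p.natDegree = d := Polynomial.natDegree_eq_of_degree_eq_some (by
    rw [hp, Polynomial.degree_add_eq_left_of_degree_lt (by rwa [Polynomial.degree_X_pow]),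
      Polynomial.degree_X_pow])
  rw [← hnat]
  refine (Finset.card_le_card (t := p.roots.toFinset) fun t ht => ?_).trans
    ((Multiset.toFinset_card_le _).trans (Polynomial.card_roots' p))
  rw [Multiset.mem_toFinset, Polynomial.mem_roots hmonic.ne_zero, Polynomial.IsRoot.def]
  simpa [hp, Polynomial.eval_finsetSum, monicEval] using hA t ht

section
variable {k d N : ℕ} {s : (Fin k → ℤ) × (Fin k → ℤ)}

/-- At most `d` of the distinct entries of `y` are roots of `q`, so `R` usable ones remain. -/
theorem exists_isRefinement_of_mem {R : ℕ} (hd : 2 * d < k) (hs : s ∈ offDiagonal k d N)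
    (hR : R + d ≤ (Finset.univ.image s.2).card) :
    ∃ (σ : Fin R → Fin k) (α : (Fin R → Fin k) → ℕ), Function.Injective (s.2 ∘ σ) ∧
      (∀ j, monicEval d (signedEsymm s.2) (s.2 (σ j)) ≠ 0) ∧
      IsRefinement s.1 (s.2 ∘ σ) (fun j => monicEval d (signedEsymm s.2) (s.2 (σ j)))
        (leadDiff d s).natAbs α := by
  set q := monicEval d (signedEsymm s.2) with hq
  have h1 := card_roots_monicEval_le d (signedEsymm s.2)
    ((Finset.univ.image s.2).filter fun t => q t = 0) fun t ht => (Finset.mem_filter.1 ht).2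
  have h2 := Finset.card_filter_add_card_filter_not (s := Finset.univ.image s.2) fun t => q t = 0
  obtain ⟨B, hBsub, hBcard⟩ := Finset.exists_subset_card_eq
    (s := (Finset.univ.image s.2).filter fun t => ¬ q t = 0) (n := R) (by omega)
  have hz : ∀ j : Fin R, ∃ i, s.2 i = (B.equivFinOfCardEq hBcard).symm j := by
    intro j
    have := hBsub ((B.equivFinOfCardEq hBcard).symm j).2
    simpa using (Finset.mem_filter.1 this).1
  choose σ hσ using hz
  have hqσ : ∀ j, q (s.2 (σ j)) ≠ 0 := fun j => by
    rw [hσ]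
    exact (Finset.mem_filter.1 (hBsub ((B.equivFinOfCardEq hBcard).symm j).2)).2
  obtain ⟨α, hα⟩ := exists_isRefinement (x := s.1) (z := s.2 ∘ σ) (q := fun j => q (s.2 (σ j)))
    (leadDiff_ne_zero hd hs) hqσ fun j => by
      have := prod_sub_sub_prod_sub_of_mem hd hs (s.2 (σ j))
      rwa [Finset.prod_eq_zero (f := fun i => s.2 (σ j) - s.2 i)
          (Finset.mem_univ (σ j)) (sub_self _), sub_zero] at this
  refine ⟨σ, α, fun a b hab => ?_, hqσ, hα⟩
  simp only [Function.comp_apply, hσ] at hab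
  exact (B.equivFinOfCardEq hBcard).symm.injective (Subtype.ext hab)

end

theorem exists_factor_of_card_image_le {k m N : ℕ} (hN : 1 ≤ N) {y : Fin k → ℤ}
    (hy : ∀ i, 1 ≤ y i ∧ y i ≤ N) (hm : (Finset.univ.image y).card ≤ m) :
    ∃ (ρ : Fin k → Fin m) (g : Fin m → ℤ), (∀ j, 1 ≤ g j ∧ g j ≤ N) ∧ y = g ∘ ρ := by
  classical
  set B := Finset.univ.image y
  let e := B.equivFin
  let ρ : Fin k → Fin m := fun i =>
    Fin.castLE hm (e ⟨y i, Finset.mem_image_of_mem y (Finset.mem_univ i)⟩)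
  -- Unused indices get the value `1`, which lies in the box.
  refine ⟨ρ, fun j => if h : (j : ℕ) < B.card then (e.symm ⟨j, h⟩ : ℤ) else 1, fun j => ?_, ?_⟩
  · dsimp only
    split_ifs with h
    · have := (e.symm ⟨j, h⟩).2
      obtain ⟨i, -, hi⟩ := Finset.mem_image.1 this
      rw [← hi]
      exact hy i
    · exact ⟨le_rfl, by exact_mod_cast hN⟩
  · funext i
    simp [ρ]

/-- Solutions in which `y` has few distinct entries. -/
theorem exists_card_le_of_card_image_le (k d m : ℕ) (hd : 2 * d < k) :
    ∃ C : ℝ, 0 < C ∧ ∀ N : ℕ, 1 ≤ N → ∀ S ⊆ offDiagonal k d N,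
      (∀ s ∈ S, (Finset.univ.image s.2).card ≤ m) → (S.card : ℝ) ≤ C * (N : ℝ) ^ (m + 1) := by
  classical
  set L := Fintype.card ((Fin k → Fin m) × Option (Fin k) × (Fin k → Fin k) × Equiv.Perm (Fin k))
    with hL
  refine ⟨L + 1, by positivity, fun N hN S hS hm => ?_⟩
  have hfac : ∀ s : S, ∃ (ρ : Fin k → Fin m) (g : Fin m → ℤ), (∀ j, 1 ≤ g j ∧ g j ≤ N) ∧
      s.1.2 = g ∘ ρ := fun s => exists_factor_of_card_image_le hN
        (mem_offDiagonal.1 (hS s.2)).1.2 (hm s.1 s.2)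
  choose ρ g hg hy using hfac
  have hid := fun s : S => prod_sub_sub_prod_sub_of_mem hd (hS s.2)
  -- Given `y`, either some `v = x i` has `q v ≠ 0`, and then `t = v` determines `h` and hence `x`
  -- at the cost of one more variable; or every `x i` is a root of `q`, so the identity at `t = x i`
  -- makes it an entry of `y`. In the second case `v = 1` is a dummy.
  have hopt : ∀ s : S, ∃ (o : Option (Fin k)) (v : ℤ) (l : Fin k → Fin k), (1 ≤ v ∧ v ≤ N) ∧
      (∀ i ∈ o, s.1.1 i = v ∧ monicEval d (signedEsymm s.1.2) v ≠ 0) ∧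
      (o = none → ∀ i, s.1.1 i = s.1.2 (l i)) := by
    intro s
    by_cases h : ∃ i, monicEval d (signedEsymm s.1.2) (s.1.1 i) ≠ 0
    · obtain ⟨i, hi⟩ := h
      refine ⟨some i, s.1.1 i, id, (mem_offDiagonal.1 (hS s.2)).1.1 i, fun a ha => ?_, by simp⟩
      obtain rfl := Option.mem_some_iff.1 ha
      exact ⟨rfl, hi⟩
    · push Not at h
      have : ∀ i, ∃ l, s.1.1 i = s.1.2 l := by
        intro i
        have h1 := hid s (s.1.1 i)
        rw [h i, mul_zero, Finset.prod_eq_zero (f := fun j => s.1.1 i - s.1.1 j)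
          (Finset.mem_univ i) (sub_self _), zero_sub, neg_eq_zero, Finset.prod_eq_zero_iff] at h1
        obtain ⟨l, -, hl⟩ := h1
        exact ⟨l, sub_eq_zero.1 hl⟩
      choose l hl using this
      exact ⟨none, 1, l, ⟨le_rfl, by exact_mod_cast hN⟩, by simp, fun _ => hl⟩
  choose o v l hv ho1 ho2 using hopt
  let T := (Finset.univ : Finset ((Fin k → Fin m) × Option (Fin k) × (Fin k → Fin k) ×
      Equiv.Perm (Fin k))) ×ˢ (Fintype.piFinset fun _ : Fin m => Finset.Icc (1 : ℤ) N) ×ˢ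
      Finset.Icc (1 : ℤ) N
  let enc : S → ((Fin k → Fin m) × Option (Fin k) × (Fin k → Fin k) × Equiv.Perm (Fin k)) ×
      (Fin m → ℤ) × ℤ := fun s => ((ρ s, o s, l s, Tuple.sort s.1.1), g s, v s)
  have hcard : (Finset.univ : Finset S).card ≤ T.card := by
    refine Finset.card_le_card_of_injOn enc (fun s _ => ?_) (fun s _ s' _ hss => ?_)
    · simp only [T, enc, Finset.coe_product, Set.mem_prod, Finset.mem_coe, Finset.mem_univ,
        Fintype.mem_piFinset, Finset.mem_Icc, true_and]
      exact ⟨hg s, hv s⟩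
    · simp only [enc, Prod.mk.injEq] at hss
      obtain ⟨⟨hρ, ho, hl, hsort⟩, hgg, hvv⟩ := hss
      have hyy : s.1.2 = s'.1.2 := by rw [hy, hy, hρ, hgg]
      refine Subtype.ext (Prod.ext ?_ hyy)
      rcases hos : o s with _ | i
      · funext i
        rw [ho2 s hos i, ho2 s' (ho ▸ hos) i, hyy, hl]
      · have h1 := ho1 s i hos
        have h2 := ho1 s' i (ho ▸ hos)
        have e1 := hid s (v s)
        have e2 := hid s' (v s')
        have z1 : ∏ j, (v s - s.1.1 j) = 0 :=
          Finset.prod_eq_zero (Finset.mem_univ i) (by rw [h1.1, sub_self])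
        have z2 : ∏ j, (v s' - s'.1.1 j) = 0 :=
          Finset.prod_eq_zero (Finset.mem_univ i) (by rw [h2.1, sub_self])
        rw [z1] at e1
        rw [z2, ← hvv, ← hyy, e1] at e2
        have hlead := mul_right_cancel₀ h1.2 e2
        refine tuple_eq_of_prod_sub_eq (fun t => ?_) hsort
        have e3 := hid s t
        have e4 := hid s' t
        rw [← hyy, ← hlead] at e4
        linarith
  have hTcard : T.card = L * N ^ (m + 1) := by
    simp [T, hL, Finset.card_product, Fintype.card_piFinset, pow_succ]
  rw [Finset.card_univ, Fintype.card_coe, hTcard] at hcard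
  have : (S.card : ℝ) ≤ L * (N : ℝ) ^ (m + 1) := by exact_mod_cast hcard
  refine this.trans ?_
  gcongr
  linarith

/-! ### The basic estimate. -/

/-- The `R` sets are disjoint, so their products multiply to a divisor of `∏ α f`, and the smallest
is at most its `R`-th root. -/
theorem exists_prod_strictMinIndices_pow_le {k R : ℕ} (hR : 0 < R) (π : Equiv.Perm (Fin k))
    {α : (Fin R → Fin k) → ℕ} (hα : ∏ f, α f ≠ 0) :
    ∃ p : Fin R, (∏ f ∈ strictMinIndices π p, α f) ^ R ≤ ∏ f, α f := by
  classical
  by_contra! hcon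
  have hdisj : (Set.univ : Set (Fin R)).PairwiseDisjoint (strictMinIndices π) :=
    pairwiseDisjoint_strictMinIndices π _
  have h1 : ∏ p, ∏ f ∈ strictMinIndices π p, α f ≤ ∏ f, α f := by
    rw [← Finset.prod_biUnion (by simpa using hdisj)]
    exact Nat.le_of_dvd (Nat.pos_of_ne_zero hα)
      (Finset.prod_dvd_prod_of_subset _ _ _ (Finset.subset_univ _))
  have h2 : (∏ f, α f) ^ R < ∏ p : Fin R, (∏ f ∈ strictMinIndices π p, α f) ^ R := by
    have : Nonempty (Fin R) := ⟨⟨0, hR⟩⟩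
    have := Finset.prod_lt_prod_of_nonempty (s := (Finset.univ : Finset (Fin R)))
      (f := fun _ => ∏ f, α f) (g := fun p => (∏ f ∈ strictMinIndices π p, α f) ^ R)
      (fun _ _ => Nat.pos_of_ne_zero hα) (fun p _ => hcon p) Finset.univ_nonempty
    simpa using this
  rw [Finset.prod_pow] at h2
  exact absurd (Nat.pow_le_pow_left h1 R) (not_le.2 h2)

/-- The first term comes from `y` with fewer than `R + d` distinct entries, the second from the
refinement. -/
theorem exists_card_offDiagonal_le (k d R : ℕ) (hd : 2 * d < k) (hR : 0 < R) {ε : ℝ}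
    (hε : 0 < ε) : ∃ C : ℝ, 0 < C ∧ ∀ N : ℕ, 1 ≤ N → ((offDiagonal k d N).card : ℝ) ≤
      C * ((N : ℝ) ^ (R + d) +
        (N : ℝ) ^ (R + (d * (d + 1) / 2 : ℕ) + ((k - d : ℕ) : ℝ) / R + ε)) := by
  classical
  obtain ⟨C₁, hC₁, h₁⟩ := exists_card_le_of_card_image_le k d (R + d - 1) hd
  obtain ⟨C₂, hC₂, h₂⟩ := exists_card_le_of_strictMinIndices k d R hd hε
  refine ⟨C₁ + C₂ * 2 ^ (k + 1), by positivity, fun N hN => ?_⟩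
  have hN1 : (1 : ℝ) ≤ N := by exact_mod_cast hN
  have hN0 : (0 : ℝ) < N := by linarith
  have hR0 : (0 : ℝ) < R := by exact_mod_cast hR
  set A := (offDiagonal k d N).filter fun s => (Finset.univ.image s.2).card ≤ R + d - 1 with hA
  set B := (offDiagonal k d N).filter fun s => ¬ (Finset.univ.image s.2).card ≤ R + d - 1 with hB
  set Q := ⌊2 ^ (k + 1) * (N : ℝ) ^ (((k - d : ℕ) : ℝ) / R)⌋₊ with hQ
  have hAB : A.card + B.card = (offDiagonal k d N).card :=
    Finset.card_filter_add_card_filter_not _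
  have hA' := h₁ N hN A (Finset.filter_subset _ _) fun s hs => (Finset.mem_filter.1 hs).2
  have hB' := h₂ N hN Q B (Finset.filter_subset _ _) fun s hs => by
    obtain ⟨hs, hcard⟩ := Finset.mem_filter.1 hs
    obtain ⟨σ, α, hinj, hq, hα⟩ := exists_isRefinement_of_mem (R := R) hd hs (by omega)
    have hne : ∏ f, α f ≠ 0 := by
      rw [hα.prod_eq]; exact Int.natAbs_ne_zero.2 (leadDiff_ne_zero hd hs)
    -- Any order of the rows serves here.
    obtain ⟨p, hp⟩ := exists_prod_strictMinIndices_pow_le hR 1 hne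
    refine ⟨σ, 1, p, α, hinj, hq, hα, Nat.le_floor ?_⟩
    have hle : ((∏ f ∈ strictMinIndices 1 p, α f : ℕ) : ℝ) ^ R ≤
        2 ^ (k + 1) * (N : ℝ) ^ (k - d) := by
      have := hp.trans (hα.prod_eq.trans_le (natAbs_leadDiff_le hs))
      exact_mod_cast this
    refine le_of_pow_le_pow_left₀ hR.ne' (by positivity) (hle.trans ?_)
    rw [mul_pow, ← Real.rpow_natCast ((N : ℝ) ^ _) R, ← Real.rpow_mul hN0.le,
      div_mul_cancel₀ _ hR0.ne', Real.rpow_natCast]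
    gcongr
    exact le_self_pow₀ (one_le_pow₀ one_le_two) hR.ne'
  have hQ' : (Q : ℝ) ≤ 2 ^ (k + 1) * (N : ℝ) ^ (((k - d : ℕ) : ℝ) / R) :=
    Nat.floor_le (by positivity)
  rw [← hAB]
  push_cast
  rw [show R + d - 1 + 1 = R + d by omega] at hA'
  set V := (N : ℝ) ^ (R + (d * (d + 1) / 2 : ℕ) + ((k - d : ℕ) : ℝ) / R + ε) with hV
  have hBV : (B.card : ℝ) ≤ C₂ * 2 ^ (k + 1) * V := by
    refine hB'.trans ?_
    calc C₂ * (N : ℝ) ^ ε * (N : ℝ) ^ (R + d * (d + 1) / 2) * Q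
        ≤ C₂ * (N : ℝ) ^ ε * (N : ℝ) ^ (R + d * (d + 1) / 2) *
          (2 ^ (k + 1) * (N : ℝ) ^ (((k - d : ℕ) : ℝ) / R)) := by gcongr
      _ = C₂ * 2 ^ (k + 1) * V := by
        rw [hV, Real.rpow_add hN0, Real.rpow_add hN0, ← Nat.cast_add, Real.rpow_natCast]
        ring
  have hV0 : 0 ≤ V := by positivity
  have hW0 : 0 ≤ (N : ℝ) ^ (R + d) := by positivity
  have e1 : 0 ≤ C₁ * V := by positivity
  have e2 : 0 ≤ C₂ * 2 ^ (k + 1) * (N : ℝ) ^ (R + d) := by positivity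
  linarith

/-! ### The power saving for `d = 0`: weights. -/

/-- The multi-indices left after revealing, in this order, the columns other than the last one,
the row `a`, the row `b`, the last column, and the other rows as ordered by `π`. -/
def mixedIndices {k r : ℕ} (π : Equiv.Perm (Fin k)) (a b : Fin k) :
    Finset (Fin (r + 1) → Fin k) :=
  {f | (f 0 = b ∧ ∀ l, l ≠ Fin.last r → f l ≠ a) ∨
    (f (Fin.last r) = a ∧ ∀ l, l ≠ Fin.last r → f l ≠ a ∧ f l ≠ b) ∨
    (f 0 ≠ a ∧ f 0 ≠ b ∧ ∀ l, π (f 0) ≤ π (f l))}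

theorem exists_perm_first {k : ℕ} (a b : Fin k) (hab : a ≠ b) : ∃ π : Equiv.Perm (Fin k),
    (∀ i, i ≠ a → π a < π i) ∧ ∀ i, i ≠ a → i ≠ b → π b < π i := by
  have hk : 1 < k := by
    have h1 := a.2
    have h2 := b.2
    have h3 : (a : ℕ) ≠ b := fun h => hab (Fin.ext h)
    omega
  set z : Fin k := ⟨0, by omega⟩ with hz
  set o : Fin k := ⟨1, hk⟩ with ho
  set π₁ := Equiv.swap a z with hπ₁
  set π := π₁.trans (Equiv.swap (π₁ b) o) with hπ
  have h1 : π₁ a = z := Equiv.swap_apply_left a z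
  have h2 : π₁ b ≠ z := fun h => hab (π₁.injective (h1.trans h.symm))
  have h3 : π a = z := by
    rw [hπ, Equiv.trans_apply, h1]
    refine Equiv.swap_apply_of_ne_of_ne h2.symm ?_
    simp [hz, ho, Fin.ext_iff]
  have h4 : π b = o := by simp [hπ]
  refine ⟨π, fun i hi => ?_, fun i hia hib => ?_⟩
  · have : π i ≠ z := fun h => hi (π.injective (h.trans h3.symm))
    have h5 : (π i : ℕ) ≠ 0 := fun h => this (Fin.ext h)
    rw [h3, Fin.lt_def]
    exact Nat.pos_of_ne_zero h5
  · have h5 : (π i : ℕ) ≠ 0 := fun h => hia (π.injective ((Fin.ext h : π i = z).trans h3.symm))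
    have h6 : (π i : ℕ) ≠ 1 := fun h => hib (π.injective ((Fin.ext h : π i = o).trans h4.symm))
    rw [h4, Fin.lt_def]
    change 1 < (π i : ℕ)
    omega

/-- A pointwise inequality of indicators. Read `A₀`, `B₀` as `f 0 = a`, `f 0 = b`; `B₁` as `f 1 =
b`; `A` as `f (Fin.last r) = a`; `M` as `f 0` coming first; `U`, `V` as the avoidance conditions in
`mixedIndices`. Under `A₀` the mixed condition fails. Under `¬ A₀` and `A ∧ B₁` it can hold only
through `B₀ ∧ U`, which `B₀ ∧ B₁` pays for. -/
theorem ite_mixed_le {x : ℝ} (hx : 0 ≤ x) {A₀ B₀ B₁ A U V M : Prop} [Decidable A₀] [Decidable B₀]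
    [Decidable B₁] [Decidable A] [Decidable U] [Decidable V] [Decidable M] (h₁ : A₀ → ¬ B₀)
    (h₂ : A₀ → M) (h₃ : B₀ → U → ¬ A → M) (h₄ : ¬ A₀ → M → ¬ A) (h₅ : V → ¬ A₀ ∧ ¬ B₁) :
    (if (B₀ ∧ U) ∨ (A ∧ V) ∨ (¬ A₀ ∧ ¬ B₀ ∧ M) then x else 0) + (if A₀ then x else 0) +
      (if A ∧ B₁ then x else 0) ≤
    (if M then x else 0) + (if A then x else 0) + (if B₀ ∧ B₁ then x else 0) := by
  by_cases a₀ : A₀ <;> by_cases b₀ : B₀ <;> by_cases a : A <;> by_cases m : M <;>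
    by_cases b₁ : B₁ <;> by_cases u : U <;> by_cases v : V <;> simp_all

section
variable {k r : ℕ} {w : (Fin (r + 1) → Fin k) → ℝ} {L : ℝ}

theorem sum_add_sum_strictMinIndices_le (hw : ∀ f, 0 ≤ w f)
    (hL : ∀ i j, ∑ f with f j = i, w f ≤ L) (π : Equiv.Perm (Fin k)) (A : Finset (Fin (r + 1)))
    (S : Finset (Fin (r + 1) → Fin k)) (hS : ∀ p ∈ A, Disjoint S (strictMinIndices π p)) :
    ∑ f ∈ S, w f + ∑ p ∈ A, ∑ f ∈ strictMinIndices π p, w f ≤ k * L := by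
  classical
  have hdisj : (A : Set (Fin (r + 1))).PairwiseDisjoint (strictMinIndices π) :=
    pairwiseDisjoint_strictMinIndices π _
  rw [← Finset.sum_biUnion hdisj, ← Finset.sum_union (by
    rw [Finset.disjoint_biUnion_right]; exact hS)]
  refine (Finset.sum_le_sum_of_subset_of_nonneg (Finset.subset_univ _) fun f _ _ => hw f).trans ?_
  rw [← Finset.sum_fiberwise (Finset.univ) (fun f => f 0) w]
  refine (Finset.sum_le_card_nsmul _ _ L fun i _ => hL i 0).trans ?_
  simp

theorem sum_marginal_ge (hL : ∀ i j, ∑ f with f j = i, w f ≤ L) {c : ℝ} (hc : c ≤ ∑ f, w f)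
    (i : Fin k) (j : Fin (r + 1)) : c - (k - 1) * L ≤ ∑ f with f j = i, w f := by
  classical
  have h1 := Finset.sum_fiberwise Finset.univ (fun f : Fin (r + 1) → Fin k => f j) w
  rw [← Finset.add_sum_erase _ _ (Finset.mem_univ i)] at h1
  have h2 : ∑ x ∈ Finset.univ.erase i, ∑ f with f j = x, w f ≤ (k - 1) * L := by
    refine (Finset.sum_le_card_nsmul _ _ L fun x _ => hL x j).trans_eq ?_
    rw [Finset.card_erase_of_mem (Finset.mem_univ i), Finset.card_univ, Fintype.card_fin,
      nsmul_eq_mul, Nat.cast_sub (by have := i.2; omega)]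
    simp
  linarith

/-- Either some product over `strictMinIndices` or some product over `mixedIndices` saves over
the average `k / (r + 1)`. -/
theorem exists_sum_le_of_marginals (hk : 0 < k) (hr : 2 ≤ r) (hw : ∀ f, 0 ≤ w f)
    (hL : ∀ i j, ∑ f with f j = i, w f ≤ L) {δ : ℝ} (hδ : 5 * (r + 1) * k * δ = 1) :
    (∃ π p, ∑ f ∈ strictMinIndices π p, w f ≤ (k / (r + 1) - δ) * L) ∨
      ∃ π a b, ∑ f ∈ mixedIndices π a b, w f ≤ (k / (r + 1) - δ) * L := by
  classical
  by_contra! hcon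
  obtain ⟨hcon1, hcon2⟩ := hcon
  set a : Fin k := ⟨0, hk⟩
  have hk0 : (0 : ℝ) < k := by exact_mod_cast hk
  have hR0 : (0 : ℝ) < (r : ℝ) + 1 := by positivity
  have hδ0 : 0 < δ := by
    by_contra! h
    have : 5 * ((r : ℝ) + 1) * k * δ ≤ 0 := mul_nonpos_of_nonneg_of_nonpos (by positivity) h
    linarith
  set β := (k / (r + 1) - δ) * L with hβ
  have hβR : (r + 1) * β = k * L - (r + 1) * δ * L := by
    rw [hβ]; field_simp
  have hall : ∀ π : Equiv.Perm (Fin k), (r + 1) * β ≤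
      ∑ p, ∑ f ∈ strictMinIndices (R := r + 1) π p, w f := by
    intro π
    have := Finset.card_nsmul_le_sum (Finset.univ : Finset (Fin (r + 1)))
      (fun p => ∑ f ∈ strictMinIndices π p, w f) β fun p _ => (hcon1 π p).le
    simpa using this
  have hL0 : 0 < L := by
    by_contra! h
    have h1 : (0 : ℝ) ≤ L := (Finset.sum_nonneg fun f _ => hw f).trans (hL a 0)
    have h2 : L = 0 := le_antisymm h h1
    have h3 := hcon1 1 0
    have h4 := sum_add_sum_strictMinIndices_le hw hL 1 {0} ∅ (by simp)
    simp only [Finset.sum_empty, Finset.sum_singleton, zero_add] at h4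
    rw [hβ, h2, mul_zero] at h3
    rw [h2, mul_zero] at h4
    linarith
  -- Near-extremality forces rigidity: the total weight is almost `k * L`, every row of every column
  -- carries almost `L`, and ties carry almost nothing.
  have htotal : k * L - (r + 1) * δ * L ≤ ∑ f, w f := by
    rw [← hβR]
    refine (hall 1).trans ?_
    rw [← Finset.sum_biUnion]
    · exact Finset.sum_le_sum_of_subset_of_nonneg (Finset.subset_univ _) fun f _ _ => hw f
    · exact pairwiseDisjoint_strictMinIndices 1 _
  have hmarg : ∀ i j, L - (r + 1) * δ * L ≤ ∑ f with f j = i, w f := by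
    intro i j
    have := sum_marginal_ge hL htotal i j
    linarith
  have htie : ∀ (i : Fin k) (j l : Fin (r + 1)), j ≠ l →
      ∑ f with f j = i ∧ f l = i, w f ≤ (r + 1) * δ * L := by
    intro i j l hjl
    -- The swap puts row `i` first. A tie in the first row lies in no strict-minimum set, and those
    -- sets already carry all but `(r + 1) * δ * L`.
    have h1 := sum_add_sum_strictMinIndices_le hw hL (Equiv.swap i a) Finset.univ
      (Finset.univ.filter fun f => f j = i ∧ f l = i) (by
        intro p _
        refine Finset.disjoint_left.2 fun f hf hf' => ?_
        simp only [strictMinIndices, Finset.mem_filter, Finset.mem_univ, true_and] at hf hf'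
        have hmin : Equiv.swap i a i = a := Equiv.swap_apply_left i a
        by_cases hp : j = p
        · have h := hf' l (hp ▸ hjl.symm)
          rw [← hp, hf.1, hf.2] at h
          exact lt_irrefl _ h
        · have h := hf' j hp
          rw [hf.1, hmin] at h
          exact absurd h (Nat.not_lt_zero _))
    have h2 := hall (Equiv.swap i a)
    linarith
  have h0last : (0 : Fin (r + 1)) ≠ Fin.last r := fun h => by
    have := congrArg Fin.val h
    rw [Fin.val_last, Fin.val_zero] at this
    omega
  have h1last : (1 : Fin (r + 1)) ≠ Fin.last r := fun h => by
    have := congrArg Fin.val h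
    rw [Fin.val_last, Fin.val_one', Nat.mod_eq_of_lt (by omega)] at this
    omega
  have h01 : (0 : Fin (r + 1)) ≠ 1 := fun h => by
    have := congrArg Fin.val h
    rw [Fin.val_zero, Fin.val_one', Nat.mod_eq_of_lt (by omega)] at this
    omega
  -- Pigeonhole on `f 1` over row `a` of the last column; the value `a` itself is a tie and hence
  -- light.
  obtain ⟨b, hab, hb⟩ : ∃ b, a ≠ b ∧ (1 - 2 * (r + 1) * δ) / k * L ≤
      ∑ f with f (Fin.last r) = a ∧ f 1 = b, w f := by
    by_contra! h
    have h1 := Finset.sum_fiberwise (Finset.univ.filter fun f : Fin (r + 1) → Fin k =>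
      f (Fin.last r) = a) (fun f => f 1) w
    simp only [Finset.filter_filter] at h1
    rw [← Finset.add_sum_erase _ _ (Finset.mem_univ a)] at h1
    have h2 := htie a (Fin.last r) 1 h1last.symm
    have h3 : ∑ x ∈ Finset.univ.erase a, ∑ f with f (Fin.last r) = a ∧ f 1 = x, w f ≤
        (k - 1) * ((1 - 2 * (r + 1) * δ) / k * L) := by
      refine (Finset.sum_le_card_nsmul _ _ _ fun x hx =>
        (h x (Finset.ne_of_mem_erase hx).symm).le).trans_eq ?_
      rw [Finset.card_erase_of_mem (Finset.mem_univ a), Finset.card_univ, Fintype.card_fin,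
        nsmul_eq_mul, Nat.cast_sub hk]
      simp
    have h4 := hmarg a (Fin.last r)
    have h5 : k * ((1 - 2 * (r + 1) * δ) / k * L) = (1 - 2 * (r + 1) * δ) * L := by field_simp
    have h6 : 0 < (1 - 2 * (r + 1) * δ) / k * L := by
      have h8 : (1 : ℝ) ≤ k := by exact_mod_cast hk
      have h7 : 5 * ((r + 1) * δ) ≤ 1 := by
        rw [← hδ]; nlinarith [mul_pos hR0 hδ0]
      have : 0 < 1 - 2 * (r + 1) * δ := by linarith [mul_pos hR0 hδ0]
      positivity
    linarith
  obtain ⟨π, hπa, hπb⟩ := exists_perm_first a b hab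
  have hmin : ∑ f with ∀ l, π (f 0) ≤ π (f l), w f + r * β ≤ k * L := by
    have h1 := sum_add_sum_strictMinIndices_le hw hL π (Finset.univ.erase 0)
      (Finset.univ.filter fun f => ∀ l, π (f 0) ≤ π (f l)) (by
        intro p hp
        refine Finset.disjoint_left.2 fun f hf hf' => ?_
        simp only [strictMinIndices, Finset.mem_filter, Finset.mem_univ, true_and] at hf hf'
        exact absurd (hf' 0 (Finset.ne_of_mem_erase hp).symm) (not_lt.2 (hf p)))
    have h2 := Finset.card_nsmul_le_sum (Finset.univ.erase (0 : Fin (r + 1)))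
      (fun p => ∑ f ∈ strictMinIndices π p, w f) β fun p _ => (hcon1 π p).le
    rw [Finset.card_erase_of_mem (Finset.mem_univ _), Finset.card_univ, Fintype.card_fin,
      Nat.add_sub_cancel, nsmul_eq_mul] at h2
    linarith
  have hkey : ∑ f ∈ mixedIndices π a b, w f + ∑ f with f 0 = a, w f +
      ∑ f with f (Fin.last r) = a ∧ f 1 = b, w f ≤
      ∑ f with ∀ l, π (f 0) ≤ π (f l), w f + ∑ f with f (Fin.last r) = a, w f +
      ∑ f with f 0 = b ∧ f 1 = b, w f := by
    simp only [mixedIndices, Finset.sum_filter, ← Finset.sum_add_distrib]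
    refine Finset.sum_le_sum fun f _ => ?_
    have hwf := hw f
    have ha_min : f 0 = a → ∀ l, π (f 0) ≤ π (f l) := by
      intro h l
      rw [h]
      by_cases hl : f l = a
      · rw [hl]
      · exact (hπa _ hl).le
    have hb_min : f 0 = b → (∀ l, l ≠ Fin.last r → f l ≠ a) → f (Fin.last r) ≠ a →
        ∀ l, π (f 0) ≤ π (f l) := by
      intro h h' hla l
      rw [h]
      have hl : f l ≠ a := by
        by_cases hl : l = Fin.last r
        · rw [hl]; exact hla
        · exact h' l hl
      by_cases hlb : f l = b
      · rw [hlb]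
      · exact (hπb _ hl hlb).le
    have hc : f 0 ≠ a → (∀ l, π (f 0) ≤ π (f l)) → f (Fin.last r) ≠ a := by
      intro h h' hla
      have := h' (Fin.last r)
      rw [hla] at this
      exact absurd (hπa _ h) (not_lt.2 this)
    exact ite_mixed_le hwf (fun h h' => hab (h.symm.trans h')) ha_min hb_min hc
      (fun h => ⟨(h 0 h0last).1, (h 1 h1last).2⟩)
  have h1 := hcon2 π a b
  have h2 := hmarg a 0
  have h3 := hL a (Fin.last r)
  have h4 := htie b 0 1 h01
  -- Here `1 / k = 5 * (r + 1) * δ`. The pigeonhole gain is at least `(5 - 2) * (r + 1) * δ * L`,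
  -- which absorbs the three errors `(r + 1) * δ * L` from `hmin`, `h2` and `h4`.
  have h5 : (1 - 2 * (r + 1) * δ) / k * L = (5 * (r + 1) * δ - 10 * (r + 1) * δ * (r + 1) * δ) * L := by
    rw [div_mul_eq_mul_div, div_eq_iff hk0.ne']
    linear_combination (-(1 - 2 * (r + 1) * δ) * L) * hδ
  have h6 : 10 * (r + 1) * δ * (r + 1) * δ ≤ 2 * (r + 1) * δ := by
    have h8 : (1 : ℝ) ≤ k := by exact_mod_cast hk
    have h7 : 5 * ((r + 1) * δ) ≤ 1 := by
      rw [← hδ]; nlinarith [mul_pos hR0 hδ0]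
    nlinarith [mul_pos hR0 hδ0]
  have h7 := mul_le_mul_of_nonneg_right h6 hL0.le
  have h8 : 0 < δ * L := mul_pos hδ0 hL0
  linarith

end

/-! ### The power saving for `d = 0`: recovery and counting. -/

open Classical in
/-- A multiple of `α f`, given by `P` and by the `x i` and `z l` which `K` declares known. -/
noncomputable def revealedMultiple {k R : ℕ} (K : (Fin R → Fin k) → Fin R → Prop) (P : ℕ)
    (z : Fin R → ℤ) (x : Fin k → ℤ) (f : Fin R → Fin k) : ℕ :=
  if h : ∃ l, K f l then (x (f h.choose) - z h.choose).natAbs else P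

section
variable {k R : ℕ} {K : (Fin R → Fin k) → Fin R → Prop} {P : ℕ}

theorem revealedMultiple_congr {z z' : Fin R → ℤ} {x x' : Fin k → ℤ} {f : Fin R → Fin k}
    (h : ∀ l, K f l → x (f l) = x' (f l) ∧ z l = z' l) :
    revealedMultiple K P z x f = revealedMultiple K P z' x' f := by
  rw [revealedMultiple, revealedMultiple]
  split_ifs with h1
  · obtain ⟨e1, e2⟩ := h _ h1.choose_spec
    rw [e1, e2]
  · rfl

theorem dvd_revealedMultiple {z : Fin R → ℤ} {x : Fin k → ℤ} {q : Fin R → ℤ} {H : ℕ}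
    {α : (Fin R → Fin k) → ℕ} (hα : IsRefinement x z q H α) {f : Fin R → Fin k}
    (hP : (∀ l, ¬ K f l) → α f ∣ P) : α f ∣ revealedMultiple K P z x f := by
  rw [revealedMultiple]
  split_ifs with h1
  · exact hα.dvd rfl
  · exact hP (not_exists.1 h1)

theorem revealedMultiple_ne_zero (hP : P ≠ 0) {z : Fin R → ℤ} {x : Fin k → ℤ}
    (hx : ∀ i j, x i ≠ z j) (f : Fin R → Fin k) : revealedMultiple K P z x f ≠ 0 := by
  rw [revealedMultiple]
  split_ifs with h1
  · exact Int.natAbs_ne_zero.2 (sub_ne_zero.2 (hx _ _))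
  · exact hP

theorem revealedMultiple_le {N : ℕ} {z : Fin R → ℤ} {x : Fin k → ℤ}
    (hx : ∀ i, 1 ≤ x i ∧ x i ≤ N) (hz : ∀ j, 1 ≤ z j ∧ z j ≤ N) (f : Fin R → Fin k) :
    revealedMultiple K P z x f ≤ max P N := by
  rw [revealedMultiple]
  split_ifs with h1
  · have h3 := hz h1.choose
    have h4 := hx (f h1.choose)
    exact le_max_of_le_right (by omega)
  · exact le_max_left _ _

theorem eq_of_revealedMultiple_eq {z z' : Fin R → ℤ} {x x' : Fin k → ℤ} {q q' : Fin R → ℤ}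
    {H H' : ℕ} {α α' : (Fin R → Fin k) → ℕ} (hα : IsRefinement x z q H α)
    (hα' : IsRefinement x' z' q' H' α') (hP0 : P ≠ 0) {f : Fin R → Fin k}
    (h : ∀ l, K f l → x (f l) = x' (f l) ∧ z l = z' l)
    (hP : (∀ l, ¬ K f l) → α f ∣ P) (hP' : (∀ l, ¬ K f l) → α' f ∣ P)
    (hc : divisorIndex (revealedMultiple K P z x f) (α f) =
      divisorIndex (revealedMultiple K P z' x' f) (α' f)) : α f = α' f := by
  rw [← revealedMultiple_congr h] at hc
  refine divisorIndex_injOn (revealedMultiple_ne_zero hP0 hα.ne f)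
    (dvd_revealedMultiple hα hP) ?_ hc
  rw [revealedMultiple_congr h]
  exact dvd_revealedMultiple hα' hP'

theorem IsRefinement.natAbs_eq {x : Fin k → ℤ} {z q : Fin R → ℤ} {H : ℕ}
    {α : (Fin R → Fin k) → ℕ} (h : IsRefinement x z q H α) (hq : ∀ j, q j = 1) (i : Fin k)
    (j : Fin R) : (x i - z j).natAbs = ∏ f with f j = i, α f := by
  obtain ⟨w, hw, h1⟩ := h.cell i j
  rw [hq, Int.natAbs_one, Nat.dvd_one] at hw
  rw [h1, hw, one_mul]

end

section
variable {k r : ℕ}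

/-- While `x b` is revealed: the entries in row `a` and not in the last column are known. -/
def KnownForRow (r : ℕ) (a : Fin k) (f : Fin (r + 1) → Fin k) (l : Fin (r + 1)) : Prop :=
  l ≠ Fin.last r ∧ f l = a

/-- While the last column is revealed: the entries in the rows `a` and `b` of the other columns
are known. -/
def KnownForColumn (r : ℕ) (a b : Fin k) (f : Fin (r + 1) → Fin k) (l : Fin (r + 1)) : Prop :=
  l ≠ Fin.last r ∧ (f l = a ∨ f l = b)

/-- While the other rows are revealed: the preceding rows are known. -/
def KnownForOrder (r : ℕ) (π : Equiv.Perm (Fin k)) (f : Fin (r + 1) → Fin k)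
    (l : Fin (r + 1)) : Prop := π (f l) < π (f 0)

/-- The tuples `x` and `z` are determined by `x a`, all but the last entry of `z`, the product
over `mixedIndices π a b` and the positions of the `α f` among the divisors of numbers that are
already known. -/
theorem eq_of_mixed_divisorIndex_eq (hr : 0 < r) {π : Equiv.Perm (Fin k)} {a b : Fin k}
    {z z' : Fin (r + 1) → ℤ} {x x' : Fin k → ℤ} {q q' : Fin (r + 1) → ℤ} {H H' : ℕ}
    {α α' : (Fin (r + 1) → Fin k) → ℕ} (hα : IsRefinement x z q H α)
    (hα' : IsRefinement x' z' q' H' α') (hq : ∀ j, q j = 1) (hq' : ∀ j, q' j = 1)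
    {P : ℕ} (hP : ∏ g ∈ mixedIndices π a b, α g = P) (hP' : ∏ g ∈ mixedIndices π a b, α' g = P)
    (hz : ∀ j : Fin r, z j.castSucc = z' j.castSucc) (ha : x a = x' a)
    (h₁ : ∀ f, divisorIndex (revealedMultiple (KnownForRow r a) P z x f) (α f) =
      divisorIndex (revealedMultiple (KnownForRow r a) P z' x' f) (α' f))
    (h₂ : ∀ f, divisorIndex (revealedMultiple (KnownForColumn r a b) P z x f) (α f) =
      divisorIndex (revealedMultiple (KnownForColumn r a b) P z' x' f) (α' f))
    (h₃ : ∀ f, divisorIndex (revealedMultiple (KnownForOrder r π) P z x f) (α f) =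
      divisorIndex (revealedMultiple (KnownForOrder r π) P z' x' f) (α' f))
    (hs : ∀ i, x i < z 0 ↔ x' i < z' 0)
    (hs' : x a < z (Fin.last r) ↔ x' a < z' (Fin.last r)) : x = x' ∧ z = z' := by
  have hP0 : P ≠ 0 := by
    rw [← hP]; exact Finset.prod_ne_zero_iff.2 fun f _ => hα.ne_zero 0 f
  have hdvd : ∀ f ∈ mixedIndices π a b, α f ∣ P ∧ α' f ∣ P := fun f hf =>
    ⟨hP ▸ Finset.dvd_prod_of_mem α hf, hP' ▸ Finset.dvd_prod_of_mem α' hf⟩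
  have hzl : ∀ l, l ≠ Fin.last r → z l = z' l := fun l hl => by
    obtain ⟨j, rfl⟩ := Fin.exists_castSucc_eq.2 hl
    exact hz j
  have h0 : (0 : Fin (r + 1)) ≠ Fin.last r := fun h => by
    have := congrArg Fin.val h
    rw [Fin.val_last, Fin.val_zero] at this
    omega
  have hz0 := hzl 0 h0
  have hcell : ∀ i j, (∀ f, f j = i → α f = α' f) →
      (x i - z j).natAbs = (x' i - z' j).natAbs := by
    intro i j hf
    rw [hα.natAbs_eq hq, hα'.natAbs_eq hq']
    exact Finset.prod_congr rfl fun f hfm => hf f (Finset.mem_filter.1 hfm).2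
  have hrow : ∀ i, (∀ f, f 0 = i → α f = α' f) → x i = x' i := by
    intro i hf
    have h4 := hcell i 0 hf
    have h5 := hs i
    rw [← hz0] at h4 h5
    exact eq_of_natAbs_eq_of_lt_iff h4 h5
  have hb : x b = x' b := by
    refine hrow b fun f hf => eq_of_revealedMultiple_eq hα hα' hP0 ?_ ?_ ?_ (h₁ f)
    · rintro l ⟨h4, h5⟩
      exact ⟨h5 ▸ ha, hzl l h4⟩
    all_goals
      intro hK
      have hmem : f ∈ mixedIndices π a b := by
        simp only [mixedIndices, Finset.mem_filter, Finset.mem_univ, true_and]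
        exact Or.inl ⟨hf, fun l hl h => hK l ⟨hl, h⟩⟩
    · exact (hdvd f hmem).1
    · exact (hdvd f hmem).2
  have hlast : z (Fin.last r) = z' (Fin.last r) := by
    have h4 := hcell a (Fin.last r) fun f hf => by
      refine eq_of_revealedMultiple_eq hα hα' hP0 ?_ ?_ ?_ (h₂ f)
      · rintro l ⟨h4, h5 | h5⟩
        · exact ⟨h5 ▸ ha, hzl l h4⟩
        · exact ⟨h5 ▸ hb, hzl l h4⟩
      all_goals
        intro hK
        have hmem : f ∈ mixedIndices π a b := by
          simp only [mixedIndices, Finset.mem_filter, Finset.mem_univ, true_and]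
          exact Or.inr (Or.inl ⟨hf, fun l hl =>
            ⟨fun h => hK l ⟨hl, Or.inl h⟩, fun h => hK l ⟨hl, Or.inr h⟩⟩⟩)
      · exact (hdvd f hmem).1
      · exact (hdvd f hmem).2
    rw [← ha] at h4 hs'
    omega
  have hzz : z = z' := funext fun l => by
    by_cases hl : l = Fin.last r
    · rw [hl]; exact hlast
    · exact hzl l hl
  refine ⟨?_, hzz⟩
  have main : ∀ n : ℕ, ∀ i, (π i : ℕ) = n → x i = x' i := by
    intro n
    induction n using Nat.strong_induction_on with
    | _ n ih =>
      intro i hi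
      by_cases hia : i = a
      · rw [hia]; exact ha
      by_cases hib : i = b
      · rw [hib]; exact hb
      refine hrow i fun f hf => eq_of_revealedMultiple_eq hα hα' hP0 ?_ ?_ ?_ (h₃ f)
      · intro l hl
        rw [KnownForOrder, hf] at hl
        exact ⟨ih _ (by rw [← hi]; exact hl) _ rfl, congrFun hzz l⟩
      all_goals
        intro hK
        have hmem : f ∈ mixedIndices π a b := by
          simp only [mixedIndices, Finset.mem_filter, Finset.mem_univ, true_and]
          exact Or.inr (Or.inr ⟨hf ▸ hia, hf ▸ hib, fun l => not_lt.1 (hK l)⟩)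
      · exact (hdvd f hmem).1
      · exact (hdvd f hmem).2
  exact funext fun i => main _ i rfl

end

theorem divisorIndex_le (n e : ℕ) : divisorIndex n e ≤ n.divisors.card :=
  Finset.card_filter_le _ _

/-- The price is again `N ^ (r + 1)`: `r` columns and the single entry `x a`. Row `b` and the last
column are then recovered from divisor labels, so only the product `P` differs from the row-by-row
count. -/
theorem exists_card_le_of_mixedIndices (k r : ℕ) (hk : 0 < k) (hr : 0 < r) {ε : ℝ} (hε : 0 < ε) :
    ∃ C : ℝ, 0 < C ∧ ∀ N : ℕ, 1 ≤ N → ∀ Q : ℕ, ∀ S ⊆ offDiagonal k 0 N,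
      (∀ s ∈ S, ∃ (σ : Fin (r + 1) → Fin k) (π : Equiv.Perm (Fin k)) (a b : Fin k)
        (α : (Fin (r + 1) → Fin k) → ℕ),
        IsRefinement s.1 (s.2 ∘ σ) (fun j => monicEval 0 (signedEsymm s.2) (s.2 (σ j)))
          (leadDiff 0 s).natAbs α ∧ ∏ f ∈ mixedIndices π a b, α f ≤ Q) →
      (S.card : ℝ) ≤ C * (N : ℝ) ^ ε * (N : ℝ) ^ (r + 1) * Q := by
  classical
  -- One label per multi-index for each of the three stages.
  set n := Fintype.card (Fin (r + 1) → Fin k) * 3 with hn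
  obtain ⟨C₀, hC₀, hdiv⟩ := exists_card_divisors_le_of_le_pow (ε := ε / (n + 1)) (by positivity)
    (2 ^ (k + 1)) k
  set L := Fintype.card ((Fin (r + 1) → Fin k) × Equiv.Perm (Fin k) × Fin k × Fin k ×
    (Fin k → Bool) × Bool × Equiv.Perm (Fin k)) with hL
  refine ⟨(L + 1) * (2 * C₀) ^ n, by positivity, fun N hN Q S hS hgood => ?_⟩
  have hN1 : (1 : ℝ) ≤ N := by exact_mod_cast hN
  have hd : 2 * 0 < k := by omega
  set M := ⌊C₀ * (N : ℝ) ^ (ε / (n + 1))⌋₊ with hM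
  have hdivM : ∀ m : ℕ, m ≠ 0 → m ≤ 2 ^ (k + 1) * N ^ k →
      m.divisors.card ≤ M := fun m h1 h2 => Nat.le_floor (hdiv N hN m h1 h2)
  have hone : ∀ (y : Fin k → ℤ) (t : ℤ), monicEval 0 (signedEsymm y) t = 1 := fun y t => by
    simp [monicEval]
  have hgood' : ∀ s : S, ∃ (σ : Fin (r + 1) → Fin k) (π : Equiv.Perm (Fin k)) (a b : Fin k)
        (α : (Fin (r + 1) → Fin k) → ℕ),
        IsRefinement s.1.1 (s.1.2 ∘ σ) (fun j => monicEval 0 (signedEsymm s.1.2) (s.1.2 (σ j)))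
          (leadDiff 0 s.1).natAbs α ∧ ∏ f ∈ mixedIndices π a b, α f ≤ Q :=
    fun s => hgood s.1 s.2
  choose σ π a b α hα hQ using hgood'
  have hbox := fun s : S => (mem_offDiagonal.1 (hS s.2)).1
  let P : S → ℕ := fun s => ∏ f ∈ mixedIndices (π s) (a s) (b s), α s f
  have hP0 : ∀ s, P s ≠ 0 := fun s =>
    Finset.prod_ne_zero_iff.2 fun f _ => (hα s).ne_zero 0 f
  have hNk : N ≤ N ^ k := Nat.le_self_pow (by omega) N
  have hPle : ∀ s, P s ≤ 2 ^ (k + 1) * N ^ k := by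
    intro s
    have h1 : P s ∣ (leadDiff 0 s.1).natAbs := by
      rw [← (hα s).prod_eq]
      exact Finset.prod_dvd_prod_of_subset _ _ _ (Finset.subset_univ _)
    exact (Nat.le_of_dvd (Nat.pos_of_ne_zero
      (Int.natAbs_ne_zero.2 (leadDiff_ne_zero hd (hS s.2)))) h1).trans
      (natAbs_leadDiff_le (hS s.2))
  let T := (Finset.univ : Finset ((Fin (r + 1) → Fin k) × Equiv.Perm (Fin k) × Fin k × Fin k ×
      (Fin k → Bool) × Bool × Equiv.Perm (Fin k))) ×ˢ
    (Fintype.piFinset fun _ : Fin r => Finset.Icc (1 : ℤ) N) ×ˢ Finset.Icc (1 : ℤ) N ×ˢ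
    Finset.Icc 1 Q ×ˢ
    (Fintype.piFinset fun _ : Fin (r + 1) → Fin k => Finset.range (M + 1)) ×ˢ
    (Fintype.piFinset fun _ : Fin (r + 1) → Fin k => Finset.range (M + 1)) ×ˢ
    (Fintype.piFinset fun _ : Fin (r + 1) → Fin k => Finset.range (M + 1))
  let lab : (((Fin (r + 1) → Fin k) → Fin (r + 1) → Prop)) → S → (Fin (r + 1) → Fin k) → ℕ :=
    fun K s f => divisorIndex (revealedMultiple K (P s) (s.1.2 ∘ σ s) s.1.1 f) (α s f)
  have hlab : ∀ K s f, lab K s f < M + 1 := by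
    intro K s f
    -- Labels are recorded for every `f` at every stage, even where `α f` need not divide the
    -- revealed number; hence the weak bound, and the range `M + 1`.
    refine Nat.lt_succ_of_le ((divisorIndex_le _ _).trans (hdivM _
      (revealedMultiple_ne_zero (hP0 s) (hα s).ne f) ?_))
    refine (revealedMultiple_le (hbox s).1 (fun j => (hbox s).2 _) f).trans (max_le (hPle s) ?_)
    exact hNk.trans (Nat.le_mul_of_pos_left _ (by positivity))
  let enc : S → ((Fin (r + 1) → Fin k) × Equiv.Perm (Fin k) × Fin k × Fin k ×
      (Fin k → Bool) × Bool × Equiv.Perm (Fin k)) × (Fin r → ℤ) × ℤ × ℕ ×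
      ((Fin (r + 1) → Fin k) → ℕ) × ((Fin (r + 1) → Fin k) → ℕ) ×
      ((Fin (r + 1) → Fin k) → ℕ) :=
    fun s => ((σ s, π s, a s, b s, fun i => decide (s.1.1 i < s.1.2 (σ s 0)),
        decide (s.1.1 (a s) < s.1.2 (σ s (Fin.last r))), Tuple.sort s.1.2),
      fun j => s.1.2 (σ s j.castSucc), s.1.1 (a s), P s, lab (KnownForRow r (a s)) s,
      lab (KnownForColumn r (a s) (b s)) s, lab (KnownForOrder r (π s)) s)
  have hcard : (Finset.univ : Finset S).card ≤ T.card := by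
    refine Finset.card_le_card_of_injOn enc (fun s _ => ?_) (fun s _ s' _ hss => ?_)
    · have hb := hbox s
      simp only [T, enc, Finset.coe_product, Set.mem_prod, Finset.mem_coe, Finset.mem_univ,
        Fintype.mem_piFinset, Finset.mem_Icc, Finset.mem_range, true_and]
      exact ⟨fun j => hb.2 _, hb.1 _, ⟨Nat.pos_of_ne_zero (hP0 s), hQ s⟩, hlab _ s, hlab _ s,
        hlab _ s⟩
    · simp only [enc, Prod.mk.injEq] at hss
      obtain ⟨⟨hσ, hπ, ha, hb, hs, hs', hsort⟩, hz, hxa, hP, h1, h2, h3⟩ := hss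
      have hxz : s.1.1 = s'.1.1 ∧ s.1.2 ∘ σ s = s'.1.2 ∘ σ s' := by
        have hα' := hα s'
        have hP' : ∏ g ∈ mixedIndices (π s') (a s') (b s'), α s' g = P s' := rfl
        have h1' := congrFun h1
        have h2' := congrFun h2
        have h3' := congrFun h3
        have hs1 := fun i => decide_eq_decide.1 (congrFun hs i)
        have hs2 := decide_eq_decide.1 hs'
        simp only [lab, ← hπ, ← ha, ← hb, ← hP] at h1' h2' h3' hP' hs2 hxa
        exact eq_of_mixed_divisorIndex_eq hr (hα s) hα' (fun j => hone _ _) (fun j => hone _ _)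
          rfl hP' (congrFun hz) hxa h1' h2' h3' hs1 hs2
      obtain ⟨hx, hzz⟩ := hxz
      have hid := prod_sub_sub_prod_sub_of_mem hd (hS s.2)
      have hid' := prod_sub_sub_prod_sub_of_mem hd (hS s'.2)
      have hzp : s.1.2 (σ s 0) = s'.1.2 (σ s' 0) := congrFun hzz 0
      have hlead : leadDiff 0 s.1 = leadDiff 0 s'.1 := by
        have h1 := hid (s.1.2 (σ s 0))
        have h2 := hid' (s'.1.2 (σ s' 0))
        rw [Finset.prod_eq_zero (f := fun i => s.1.2 (σ s 0) - s.1.2 i)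
          (Finset.mem_univ (σ s 0)) (sub_self _), sub_zero, hone, mul_one] at h1
        rw [Finset.prod_eq_zero (f := fun i => s'.1.2 (σ s' 0) - s'.1.2 i)
          (Finset.mem_univ (σ s' 0)) (sub_self _), sub_zero, hone, mul_one, ← hzp, ← hx, h1] at h2
        exact h2
      have hy : s.1.2 = s'.1.2 := by
        refine tuple_eq_of_prod_sub_eq (fun t => ?_) hsort
        have h1 := hid t
        have h2 := hid' t
        rw [← hx, ← hlead, hone] at h2
        rw [hone] at h1
        linarith
      exact Subtype.ext (Prod.ext hx hy)
  have hX1 : (1 : ℝ) ≤ C₀ * (N : ℝ) ^ (ε / (n + 1)) :=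
    one_le_mul_of_one_le_of_one_le hC₀ (Real.one_le_rpow hN1 (by positivity))
  have hM' : ((M + 1 : ℕ) : ℝ) ≤ 2 * C₀ * (N : ℝ) ^ (ε / (n + 1)) := by
    have : (M : ℝ) ≤ C₀ * (N : ℝ) ^ (ε / (n + 1)) := Nat.floor_le (by positivity)
    push_cast
    linarith
  have hMn : ((M + 1 : ℕ) : ℝ) ^ n ≤ (2 * C₀) ^ n * (N : ℝ) ^ ε := by
    refine (pow_le_pow_left₀ (Nat.cast_nonneg _) hM' n).trans ?_
    rw [mul_pow, ← Real.rpow_natCast ((N : ℝ) ^ _) n, ← Real.rpow_mul (by positivity)]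
    gcongr
    rw [div_mul_eq_mul_div, div_le_iff₀ (by positivity)]
    nlinarith
  have hTcard : T.card = L * (N ^ r * (N * (Q * (M + 1) ^ n))) := by
    simp only [T, Finset.card_product, Fintype.card_piFinset, hn, hL, Finset.card_univ,
      Finset.prod_const, Int.card_Icc, Nat.card_Icc, Finset.card_range, add_sub_cancel_right,
      Int.toNat_natCast, Fintype.card_fin, Nat.add_sub_cancel]
    ring
  rw [Finset.card_univ, Fintype.card_coe, hTcard] at hcard
  have hfin : (S.card : ℝ) ≤ L * ((N : ℝ) ^ r * (N * (Q * ((M + 1 : ℕ) : ℝ) ^ n))) := by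
    exact_mod_cast hcard
  refine hfin.trans ?_
  calc (L : ℝ) * ((N : ℝ) ^ r * (N * (Q * ((M + 1 : ℕ) : ℝ) ^ n)))
      ≤ (L + 1) * ((N : ℝ) ^ r * (N * (Q * ((2 * C₀) ^ n * (N : ℝ) ^ ε)))) := by
        gcongr; linarith
    _ = _ := by rw [pow_succ]; ring

/-- The case `d = 0`, with a power saving over `exists_card_offDiagonal_le`. -/
theorem exists_card_offDiagonal_zero_le (k r : ℕ) (hk : 0 < k) (hr : 2 ≤ r) {ε : ℝ}
    (hε : 0 < ε) : ∃ C : ℝ, 0 < C ∧ ∀ N : ℕ, 1 ≤ N → ((offDiagonal k 0 N).card : ℝ) ≤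
      C * ((N : ℝ) ^ (r + 1) +
        (N : ℝ) ^ ((r + 1 : ℕ) + ((k : ℝ) / (r + 1) - 1 / (5 * (r + 1) * k)) + ε)) := by
  classical
  have hd : 2 * 0 < k := by omega
  have hk0 : (0 : ℝ) < k := by exact_mod_cast hk
  set β : ℝ := (k : ℝ) / (r + 1) - 1 / (5 * (r + 1) * k) with hβ
  obtain ⟨C₁, hC₁, h₁⟩ := exists_card_le_of_card_image_le k 0 r hd
  obtain ⟨C₂, hC₂, h₂⟩ := exists_card_le_of_strictMinIndices k 0 (r + 1) hd hε
  obtain ⟨C₃, hC₃, h₃⟩ := exists_card_le_of_mixedIndices k r hk (by omega) hε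
  refine ⟨C₁ + C₂ + C₃, by positivity, fun N hN => ?_⟩
  have hN1 : (1 : ℝ) ≤ N := by exact_mod_cast hN
  have hN0 : (0 : ℝ) < N := by linarith
  set Q := ⌊(N : ℝ) ^ β⌋₊ with hQ
  set good : (Fin k → ℤ) × (Fin k → ℤ) → Prop := fun s =>
    ∃ (σ : Fin (r + 1) → Fin k) (π : Equiv.Perm (Fin k)) (p : Fin (r + 1))
        (α : (Fin (r + 1) → Fin k) → ℕ), Function.Injective (s.2 ∘ σ) ∧
        (∀ j, monicEval 0 (signedEsymm s.2) (s.2 (σ j)) ≠ 0) ∧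
        IsRefinement s.1 (s.2 ∘ σ) (fun j => monicEval 0 (signedEsymm s.2) (s.2 (σ j)))
          (leadDiff 0 s).natAbs α ∧ ∏ f ∈ strictMinIndices π p, α f ≤ Q with hgood
  set A := (offDiagonal k 0 N).filter fun s => (Finset.univ.image s.2).card ≤ r with hA
  set B := (offDiagonal k 0 N).filter fun s => ¬ (Finset.univ.image s.2).card ≤ r with hB
  have hAB : A.card + B.card = (offDiagonal k 0 N).card :=
    Finset.card_filter_add_card_filter_not _
  have hBB : (B.filter good).card + (B.filter fun s => ¬ good s).card = B.card :=
    Finset.card_filter_add_card_filter_not _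
  have hA' := h₁ N hN A (Finset.filter_subset _ _) fun s hs => (Finset.mem_filter.1 hs).2
  have hB₁ := h₂ N hN Q (B.filter good)
    ((Finset.filter_subset _ _).trans (Finset.filter_subset _ _))
    fun s hs => (Finset.mem_filter.1 hs).2
  have hB₂ := h₃ N hN Q (B.filter fun s => ¬ good s)
    ((Finset.filter_subset _ _).trans (Finset.filter_subset _ _)) fun s hs => by
    obtain ⟨hsB, hng⟩ := Finset.mem_filter.1 hs
    obtain ⟨hs, hcard⟩ := Finset.mem_filter.1 hsB
    obtain ⟨σ, α, hinj, hq, hα⟩ := exists_isRefinement_of_mem (R := r + 1) hd hs (by omega)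
    have hbox := (mem_offDiagonal.1 hs).1
    have hpos : ∀ f, 0 < α f := fun f => Nat.pos_of_ne_zero (hα.ne_zero 0 f)
    have hlog : ∀ U : Finset (Fin (r + 1) → Fin k),
        ∑ f ∈ U, Real.log (α f) = Real.log ((∏ f ∈ U, α f : ℕ) : ℝ) := by
      intro U
      rw [Nat.cast_prod, Real.log_prod fun f _ => by exact_mod_cast (hpos f).ne']
    have hto : ∀ U : Finset (Fin (r + 1) → Fin k),
        ∑ f ∈ U, Real.log (α f) ≤ β * Real.log N → ∏ f ∈ U, α f ≤ Q := by
      intro U hU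
      refine Nat.le_floor ?_
      have hp : (0 : ℝ) < ((∏ f ∈ U, α f : ℕ) : ℝ) := by
        exact_mod_cast Finset.prod_pos fun f _ => hpos f
      rw [hlog, ← Real.log_rpow hN0] at hU
      exact (Real.log_le_log_iff hp (by positivity)).1 hU
    -- For `d = 0`, `q = 1`, so each marginal product is exactly `|x i - z j| ≤ N`: the weights `log
    -- α f` have marginals at most `log N`.
    rcases exists_sum_le_of_marginals (w := fun f => Real.log (α f)) (L := Real.log N)
      (δ := 1 / (5 * (r + 1) * k)) hk hr
      (fun f => Real.log_natCast_nonneg _) (fun i j => by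
        rw [hlog]
        refine Real.log_le_log (by exact_mod_cast Finset.prod_pos fun f _ => hpos f) ?_
        rw [← hα.natAbs_eq (fun j => by simp [monicEval])]
        have h4 := hbox.1 i
        have h5 := hbox.2 (σ j)
        have h6 : (s.1 i - s.2 (σ j)).natAbs ≤ N := by omega
        exact_mod_cast h6) (by field_simp) with ⟨π, p, h⟩ | ⟨π, a, b, h⟩
    · exact absurd ⟨σ, π, p, α, hinj, hq, hα, hto _ h⟩ hng
    · exact ⟨σ, π, a, b, α, hα, hto _ h⟩
  have hQ' : (Q : ℝ) ≤ (N : ℝ) ^ β := Nat.floor_le (by positivity)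
  set V := (N : ℝ) ^ ((r + 1 : ℕ) + β + ε) with hV
  have hVeq : ∀ C : ℝ, 0 < C → C * (N : ℝ) ^ ε * (N : ℝ) ^ (r + 1) * Q ≤ C * V := by
    intro C hC
    calc C * (N : ℝ) ^ ε * (N : ℝ) ^ (r + 1) * Q
        ≤ C * (N : ℝ) ^ ε * (N : ℝ) ^ (r + 1) * (N : ℝ) ^ β := by gcongr
      _ = C * V := by
        rw [hV, Real.rpow_add hN0, Real.rpow_add hN0, Real.rpow_natCast]
        ring
  have hB₁' := hB₁.trans (hVeq C₂ hC₂)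
  have hB₂' := hB₂.trans (hVeq C₃ hC₃)
  rw [← hAB, ← hBB]
  push_cast
  have hV0 : 0 ≤ V := by positivity
  have hW0 : 0 ≤ (N : ℝ) ^ (r + 1) := by positivity
  have e1 : 0 ≤ C₁ * V := by positivity
  have e2 : 0 ≤ (C₂ + C₃) * (N : ℝ) ^ (r + 1) := by positivity
  linarith

/-! ### Optimising `R`, and the conclusion. -/

/-- With `s = √(4K+1)`, `(s - (R + K/R)) * R = (R - (s-1)/2) * ((s-1)/2 + 1 - R)`. At `R =
⌈(s-1)/2⌉` the first factor is nonnegative and the second positive, so equality means `s = 2R + 1`.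
-/
theorem exists_nat_add_div_le_sqrt (K : ℕ) (hK : 0 < K) : ∃ R : ℕ, 0 < R ∧
    (R : ℝ) + K / R ≤ √(4 * K + 1) ∧
    ((R : ℝ) + K / R = √(4 * K + 1) → K = R * (R + 1)) := by
  have hK0 : (0 : ℝ) < K := by exact_mod_cast hK
  set s := √(4 * (K : ℝ) + 1) with hs
  have hs2 : s * s = 4 * K + 1 := Real.mul_self_sqrt (by positivity)
  have hs1 : 1 < s := by
    rw [hs, Real.lt_sqrt zero_le_one]; linarith
  set R := ⌈(s - 1) / 2⌉₊ with hR
  have hR0 : 0 < R := Nat.ceil_pos.2 (by linarith)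
  have hRp : (0 : ℝ) < R := by exact_mod_cast hR0
  have h1 : (s - 1) / 2 ≤ R := Nat.le_ceil _
  have h2 : (R : ℝ) < (s - 1) / 2 + 1 := Nat.ceil_lt_add_one (by linarith)
  have h3 : (s - ((R : ℝ) + K / R)) * R = (R - (s - 1) / 2) * ((s - 1) / 2 + 1 - R) := by
    field_simp
    linear_combination hs2
  refine ⟨R, hR0, ?_, fun heq => ?_⟩
  · have h4 : 0 ≤ (s - ((R : ℝ) + K / R)) * R := by
      rw [h3]; exact mul_nonneg (by linarith) (by linarith)
    linarith [nonneg_of_mul_nonneg_left h4 hRp]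
  · rw [heq, sub_self, zero_mul, eq_comm, mul_eq_zero] at h3
    have h5 : (R : ℝ) = (s - 1) / 2 := by
      rcases h3 with h | h
      · linarith
      · linarith
    have h6 : s = 2 * R + 1 := by linarith
    rw [h6] at hs2
    have : (K : ℝ) = (R * (R + 1) : ℕ) := by push_cast; linarith
    exact_mod_cast this

theorem natCast_half_mul_succ (d : ℕ) :
    ((d * (d + 1) / 2 : ℕ) : ℝ) = (d : ℝ) * ((d : ℝ) + 1) / 2 := by
  rw [Nat.cast_div (Nat.even_mul_succ_self d).two_dvd two_ne_zero]
  push_cast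
  ring

theorem natCast_le_half_mul_succ (d : ℕ) : (d : ℝ) ≤ (d : ℝ) * ((d : ℝ) + 1) / 2 := by
  rcases Nat.eq_zero_or_pos d with rfl | hd
  · simp
  have : (1 : ℝ) ≤ d := by exact_mod_cast hd
  nlinarith

theorem exists_card_offDiagonal_le_of_add_div_lt {k d R : ℕ} (hd : 2 * d < k) (hR : 0 < R)
    (h : (R : ℝ) + ((k - d : ℕ) : ℝ) / R < √(4 * k + 1)) :
    ∃ C : ℝ, 0 < C ∧ ∀ N : ℕ, 1 ≤ N → ((offDiagonal k d N).card : ℝ) ≤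
      C * (N : ℝ) ^ (√(4 * k + 1) + (d : ℝ) * ((d : ℝ) + 1) / 2) := by
  obtain ⟨C, hC, hle⟩ := exists_card_offDiagonal_le k d R hd hR
    (ε := √(4 * k + 1) - ((R : ℝ) + ((k - d : ℕ) : ℝ) / R)) (by linarith)
  refine ⟨2 * C, by positivity, fun N hN => (hle N hN).trans ?_⟩
  have hN1 : (1 : ℝ) ≤ N := by exact_mod_cast hN
  rw [mul_comm 2 C, mul_assoc, two_mul]
  refine mul_le_mul_of_nonneg_left (add_le_add ?_ ?_) hC.le
  · rw [← Real.rpow_natCast]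
    refine Real.rpow_le_rpow_of_exponent_le hN1 ?_
    have h1 : 0 ≤ ((k - d : ℕ) : ℝ) / R := by positivity
    have h2 := natCast_le_half_mul_succ d
    push_cast
    linarith
  · refine Real.rpow_le_rpow_of_exponent_le hN1 ?_
    linarith [natCast_half_mul_succ d]

theorem exists_card_offDiagonal_le_sqrt {k d : ℕ} (hk : 2 ≤ k) (hdk : (d : ℝ) ≤ √k) :
    ∃ C : ℝ, 0 < C ∧ ∀ N : ℕ, 1 ≤ N → ((offDiagonal k d N).card : ℝ) ≤
      C * (N : ℝ) ^ (√(4 * k + 1) + (d : ℝ) * ((d : ℝ) + 1) / 2) := by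
  have hdd : d * d ≤ k := by
    have := (Real.le_sqrt (Nat.cast_nonneg d) (Nat.cast_nonneg k)).1 hdk
    rw [sq] at this
    exact_mod_cast this
  have htriv : ∀ m : ℕ, (m : ℝ) ≤ √(4 * k + 1) + (d : ℝ) * ((d : ℝ) + 1) / 2 →
      (∀ N, (offDiagonal k d N).card ≤ N ^ m) → ∃ C : ℝ, 0 < C ∧ ∀ N : ℕ, 1 ≤ N →
        ((offDiagonal k d N).card : ℝ) ≤
          C * (N : ℝ) ^ (√(4 * k + 1) + (d : ℝ) * ((d : ℝ) + 1) / 2) := by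
    intro m hm hle
    refine ⟨1, one_pos, fun N hN => ?_⟩
    have h1 : ((offDiagonal k d N).card : ℝ) ≤ (N : ℝ) ^ m := by exact_mod_cast hle N
    rw [one_mul]
    refine h1.trans ?_
    rw [← Real.rpow_natCast]
    exact Real.rpow_le_rpow_of_exponent_le (by exact_mod_cast hN) hm
  by_cases h2d : 2 * d < k
  · obtain ⟨R, hR, hle, heq⟩ := exists_nat_add_div_le_sqrt (k - d) (by omega)
    rcases Nat.eq_zero_or_pos d with rfl | hd
    · simp only [Nat.sub_zero] at hle heq
      rcases hle.lt_or_eq with hlt | he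
      · exact exists_card_offDiagonal_le_of_add_div_lt h2d hR (by simpa using hlt)
      have hkR := heq he
      have hs : √(4 * k + 1) = 2 * (R : ℝ) + 1 := by
        rw [hkR, Real.sqrt_eq_iff_mul_self_eq (by positivity) (by positivity)]
        push_cast; ring
      -- The saving needs three distinct columns. For `R = 1`, `k = 2` the target exponent is `3`,
      -- which the linear equation alone provides.
      by_cases hR1 : R = 1
      · subst hR1
        obtain rfl : k = 1 + 1 := hkR
        refine htriv 3 ?_ fun N => card_offDiagonal_succ_le (by omega)
        rw [hs]; norm_num
      have hk0 : (0 : ℝ) < k := by exact_mod_cast (by omega : 0 < k)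
      -- With `R + 1` columns the exponent `R + 1 + k/(R+1)` is again `2R + 1`; `ε` is taken equal
      -- to the saving.
      obtain ⟨C, hC, hle'⟩ := exists_card_offDiagonal_zero_le k R (by omega) (by omega)
        (ε := 1 / (5 * (R + 1) * k)) (by positivity)
      refine ⟨2 * C, by positivity, fun N hN => (hle' N hN).trans ?_⟩
      have hN1 : (1 : ℝ) ≤ N := by exact_mod_cast hN
      have hRR : (k : ℝ) / (R + 1) = R := by
        rw [hkR]; push_cast; field_simp
      rw [mul_comm (2 : ℝ) C, mul_assoc C (2 : ℝ), two_mul ((N : ℝ) ^ _), hs]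
      refine mul_le_mul_of_nonneg_left (add_le_add ?_ ?_) hC.le
      · rw [← Real.rpow_natCast]
        refine Real.rpow_le_rpow_of_exponent_le hN1 ?_
        push_cast
        have : (0 : ℝ) ≤ R := by positivity
        linarith
      · refine Real.rpow_le_rpow_of_exponent_le hN1 ?_
        rw [hRR]
        push_cast
        linarith
    · refine exists_card_offDiagonal_le_of_add_div_lt h2d hR (hle.trans_lt ?_)
      refine Real.sqrt_lt_sqrt (by positivity) ?_
      have : ((k - d : ℕ) : ℝ) < k := by exact_mod_cast (by omega : k - d < k)
      linarith
  -- From `d * d ≤ k ≤ 2 * d` only `(k, d) = (2, 1)` and `(4, 2)` remain.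
  · have hd2 : d ≤ 2 := by nlinarith
    have hd1 : 1 ≤ d := by omega
    interval_cases d
    · obtain rfl : k = 2 := by omega
      refine htriv 4 ?_ fun N => card_offDiagonal_le 2 1 N
      have : (3 : ℝ) ≤ √(4 * (2 : ℕ) + 1) := by
        rw [Real.le_sqrt' (by norm_num)]; norm_num
      norm_num at this ⊢
    · obtain rfl : k = 3 + 1 := by omega
      refine htriv 7 ?_ fun N => card_offDiagonal_succ_le (by omega)
      have : (4 : ℝ) ≤ √(4 * (3 + 1 : ℕ) + 1) := by
        rw [Real.le_sqrt' (by norm_num)]; norm_num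
      norm_num at this ⊢
      linarith

theorem abs_solutionCount_sub_diagonalCount_le {k d : ℕ} {C E : ℝ} (hC : 0 ≤ C) (hE : 0 ≤ E)
    (h : ∀ N : ℕ, 1 ≤ N → ((offDiagonal k d N).card : ℝ) ≤ C * (N : ℝ) ^ E) {X : ℝ} (hX : 1 ≤ X) :
    |(solutionCount k d X : ℝ) - (diagonalCount k X : ℝ)| ≤ C * X ^ E := by
  rw [abs_solutionCount_sub_diagonalCount k d hX]
  refine (h ⌊X⌋₊ (Nat.le_floor (by simpa using hX))).trans ?_
  gcongr
  exact Nat.floor_le (by linarith)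

theorem tendsto_sqrt_exponent {d : ℕ → ℕ}
    (hd : (fun k : ℕ => (d k : ℝ)) =o[atTop] (fun k : ℕ => (k : ℝ) ^ (1 / 4 : ℝ))) :
    Tendsto (fun k : ℕ => (√(4 * (k : ℝ) + 1) + (d k : ℝ) * ((d k : ℝ) + 1) / 2) / √k - 2)
      atTop (𝓝 0) := by
  have h1 : Tendsto (fun k : ℕ => √(4 + 1 / (k : ℝ))) atTop (𝓝 2) := by
    have h : Tendsto (fun k : ℕ => √(4 + 1 / (k : ℝ))) atTop (𝓝 √(4 + 0)) :=
      (tendsto_const_nhds.add tendsto_one_div_atTop_nhds_zero_nat).sqrt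
    have h4 : √(4 : ℝ) = 2 := by
      rw [show (4 : ℝ) = 2 ^ 2 by norm_num, Real.sqrt_sq zero_le_two]
    rwa [add_zero, h4] at h
  have h2 : Tendsto (fun k : ℕ => ((d k : ℝ) / (k : ℝ) ^ (1 / 4 : ℝ)) ^ 2) atTop (𝓝 0) := by
    simpa using hd.tendsto_div_nhds_zero.pow 2
  have h3 : Tendsto (fun k : ℕ => (d k : ℝ) * ((d k : ℝ) + 1) / 2 / √k) atTop (𝓝 0) := by
    refine squeeze_zero (fun k => by positivity) (fun k => ?_) h2
    have e1 : ((k : ℝ) ^ (1 / 4 : ℝ)) ^ 2 = √k := by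
      rw [← Real.rpow_natCast, ← Real.rpow_mul (Nat.cast_nonneg k), Real.sqrt_eq_rpow]
      norm_num
    rw [div_pow, e1]
    gcongr
    rcases Nat.eq_zero_or_pos (d k) with h0 | h0
    · simp [h0]
    have : (1 : ℝ) ≤ d k := by exact_mod_cast h0
    nlinarith
  have h4 := (h1.add h3).sub_const 2
  rw [add_zero, sub_self] at h4
  refine h4.congr' ?_
  filter_upwards [eventually_gt_atTop 0] with k hk
  have hk0 : (0 : ℝ) < k := by exact_mod_cast hk
  rw [add_div, ← Real.sqrt_div (by positivity), add_div, mul_div_cancel_right₀ _ hk0.ne']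

theorem corollary1p2 :
    (∀ k : ℕ, 2 ≤ k → ∃ C : ℝ, 0 < C ∧
      ∀ d : ℕ, (d : ℝ) ≤ Real.sqrt (k : ℝ) → ∀ X : ℝ, 1 ≤ X →
        |(solutionCount k d X : ℝ) - (diagonalCount k X : ℝ)| ≤
          C * X ^ (Real.sqrt (4 * (k : ℝ) + 1) + (d : ℝ) * ((d : ℝ) + 1) / 2)) ∧
    (∀ d : ℕ → ℕ,
      (fun k : ℕ => (d k : ℝ)) =o[atTop] (fun k : ℕ => (k : ℝ) ^ (1 / 4 : ℝ)) →
      ∃ e : ℕ → ℝ, Tendsto e atTop (𝓝 0) ∧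
        ∀ k : ℕ, 2 ≤ k → d k < k → ∃ C : ℝ, 0 < C ∧ ∀ X : ℝ, 1 ≤ X →
          |(solutionCount k (d k) X : ℝ) - (diagonalCount k X : ℝ)| ≤
            C * X ^ ((2 + e k) * Real.sqrt (k : ℝ))) := by
  classical
  constructor
  · intro k hk
    have hall : ∀ d : ℕ, ∃ C : ℝ, 0 < C ∧ ((d : ℝ) ≤ √k → ∀ N : ℕ, 1 ≤ N →
        ((offDiagonal k d N).card : ℝ) ≤
          C * (N : ℝ) ^ (√(4 * k + 1) + (d : ℝ) * ((d : ℝ) + 1) / 2)) := by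
      intro d
      by_cases hd : (d : ℝ) ≤ √k
      · obtain ⟨C, hC, h⟩ := exists_card_offDiagonal_le_sqrt hk hd
        exact ⟨C, hC, fun _ => h⟩
      · exact ⟨1, one_pos, fun h => absurd h hd⟩
    choose C hC hle using hall
    have hmem : ∀ d : ℕ, (d : ℝ) ≤ √k → d ∈ Finset.range (k + 1) := by
      intro d hd
      have hk1 : (1 : ℝ) ≤ k := by exact_mod_cast (by omega : 1 ≤ k)
      have h1 : √(k : ℝ) ≤ k := Real.sqrt_le_iff.2 ⟨by positivity, by nlinarith⟩
      have : d ≤ k := by exact_mod_cast hd.trans h1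
      exact Finset.mem_range.2 (by omega)
    -- Only finitely many `d` satisfy `d ≤ √k`, so the sum of their constants serves for all.
    refine ⟨∑ d ∈ Finset.range (k + 1), C d, Finset.sum_pos (fun d _ => hC d) (by simp),
      fun d hd X hX => ?_⟩
    refine (abs_solutionCount_sub_diagonalCount_le (hC d).le (by positivity) (hle d hd) hX).trans ?_
    gcongr
    exact Finset.single_le_sum (f := C) (fun d _ => (hC d).le) (hmem d hd)
  · intro d hd
    -- For `d k > √k`, which happens for finitely many `k`, the value `2 * √k` makes the exponent at
    -- least `2 * k`, and the trivial bound suffices.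
    refine ⟨fun k => if (d k : ℝ) ≤ √k then
      (√(4 * (k : ℝ) + 1) + (d k : ℝ) * ((d k : ℝ) + 1) / 2) / √k - 2 else 2 * √k, ?_, ?_⟩
    · refine (tendsto_sqrt_exponent hd).congr' ?_
      filter_upwards [hd.bound one_pos, eventually_ge_atTop 1] with k hk hk1
      have hk1' : (1 : ℝ) ≤ k := by exact_mod_cast hk1
      rw [if_pos]
      rw [one_mul, Real.norm_of_nonneg (by positivity), Real.norm_of_nonneg (by positivity)] at hk
      refine hk.trans ?_
      rw [Real.sqrt_eq_rpow]
      exact Real.rpow_le_rpow_of_exponent_le hk1' (by norm_num)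
    · intro k hk _
      have hk0 : (0 : ℝ) < k := by exact_mod_cast (by omega : 0 < k)
      have hs : 0 < √(k : ℝ) := Real.sqrt_pos.2 hk0
      dsimp only
      split_ifs with hdk
      · obtain ⟨C, hC, h⟩ := exists_card_offDiagonal_le_sqrt hk hdk
        refine ⟨C, hC, fun X hX => ?_⟩
        rw [add_sub_cancel, div_mul_cancel₀ _ hs.ne']
        exact abs_solutionCount_sub_diagonalCount_le hC.le (by positivity) h hX
      · refine ⟨1, one_pos, fun X hX =>
          abs_solutionCount_sub_diagonalCount_le zero_le_one (by positivity) (fun N hN => ?_) hX⟩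
        have h1 : ((offDiagonal k (d k) N).card : ℝ) ≤ (N : ℝ) ^ (2 * k) := by
          exact_mod_cast card_offDiagonal_le k (d k) N
        rw [one_mul]
        refine h1.trans ?_
        rw [← Real.rpow_natCast]
        refine Real.rpow_le_rpow_of_exponent_le (by exact_mod_cast hN) ?_
        have := Real.mul_self_sqrt hk0.le
        push_cast
        nlinarith
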